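/- Let $d\ge 1$, let $\mathbb T^d=\mathbb R^d/\mathbb Z^d$, let $0<\alpha<1$ and $\lambda=d-2+2\alpha$, and assume $\lambda>0$ (automatic when $d\ge2$); thus $d-2<\lambda<d$. Let $\theta_0,\theta_1,C_g>0$ and $\Lambda,C_V,K\ge0$. Let $g:\mathbb R\to\mathbb R$ be locally Lipschitz with $g(s)\,\mathrm{sign}(s)\ge C_g|s|-\frac1{C_g}$ for all $s\in\mathbb R$. Then there is a constant $C>0$, depending only on $d,\alpha,\theta_0,\theta_1,\Lambda,C_g,g,C_V$ and $K$, with the following property. Let $A=(a_{ij})$ be a measurable $d\times d$ matrix field on $\mathbb T^d$ such that $\theta_0|z|^2\le zA(x)z^T\le\theta_1|z|^2$ and $|a_{ij}(x)|\le\Lambda$ for all $x\in\mathbb T^d$, $z\in\mathbb R^d$ and all $i,j$ (if $A$ is symmetric, the bound on the entries holds with $\Lambda=\theta_1$). Let $V:\mathbb T^d\to\mathbb R$ be continuous and $\overline H\in\mathbb R$ with $|V-\overline H|\le C_V$ on $\mathbb T^d$. Let $u\in H^1(\mathbb T^d)\cap C^{0,\alpha}(\mathbb T^d)$, with $|u(x)-u(y)|\le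 K\,\mathrm{dist}(x,y)^\alpha$ for all $x,y\in\mathbb T^d$, solve $$-\mathrm{div}(A\,Du^T)+\tfrac12\,Du\,A\,Du^T+V-\overline H-g(-u)=0$$ in the sense of distributions, that is, $$\int_{\mathbb T^d} D\varphi\,A\,Du^T+\Big(\tfrac12 Du\,A\,Du^T+V-\overline H-g(-u)\Big)\varphi\,dx=0\qquad\text{for all }\varphi\in C^\infty(\mathbb T^d).$$ Then $Du$ belongs to the Morrey space $L^{2,\lambda}(\mathbb T^d)$, and $$\|Du\|_{L^{2,\lambda}(\mathbb T^d)}=\sup_{x\in\mathbb T^d,\ r>0}\Big(\frac1{r^\lambda}\int_{B(x,r)}|Du|^2\,dy\Big)^{1/2}\le C,$$ where $B(x,r)$ is the ball of radius $r$ around $x$ in $\mathbb T^d$. -/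

import Mathlib

open MeasureTheory
open scoped ENNReal ContDiff

noncomputable section

/-- Functions on the unit torus `ℝ^d / ℤ^d` are represented by `ℤ^d`-periodic functions on `ℝ^d`. -/
def TorusPeriodic {d : ℕ} {β : Type*} (f : EuclideanSpace ℝ (Fin d) → β) : Prop :=
  ∀ (k : Fin d → ℤ) (x : EuclideanSpace ℝ (Fin d)),
    f (x + WithLp.toLp 2 (fun i => (k i : ℝ))) = f x

/-- The half-open unit cube, a fundamental domain of the torus. -/
def unitCube (d : ℕ) : Set (EuclideanSpace ℝ (Fin d)) :=
  {x | ∀ i, x i ∈ Set.Ico (0 : ℝ) 1}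

/-- The open geodesic ball of the flat torus, as a `ℤ^d`-periodic subset of `ℝ^d`. -/
def torusBall {d : ℕ} (x : EuclideanSpace ℝ (Fin d)) (r : ℝ) : Set (EuclideanSpace ℝ (Fin d)) :=
  {y | ∃ k : Fin d → ℤ, dist (y + WithLp.toLp 2 (fun i => (k i : ℝ))) x < r}

/-- `p M qᵀ = ∑ i j, pᵢ Mᵢⱼ qⱼ`. -/
def matForm {d : ℕ} (M : Matrix (Fin d) (Fin d) ℝ) (p q : EuclideanSpace ℝ (Fin d)) : ℝ :=
  ∑ i, ∑ j, p i * M i j * q j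

/-- Test functions: smooth functions on the torus. -/
def IsTorusTest {d : ℕ} (φ : EuclideanSpace ℝ (Fin d) → ℝ) : Prop :=
  ContDiff ℝ ∞ φ ∧ TorusPeriodic φ

/-- `u ∈ H¹(𝕋^d)`, and `Du` is (a representative of) its weak gradient. -/
structure IsTorusH1 {d : ℕ} (u : EuclideanSpace ℝ (Fin d) → ℝ)
    (Du : EuclideanSpace ℝ (Fin d) → EuclideanSpace ℝ (Fin d)) : Prop where
  periodic : TorusPeriodic u
  periodic_grad : TorusPeriodic Du
  memLp : MemLp u 2 (volume.restrict (unitCube d))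
  memLp_grad : MemLp Du 2 (volume.restrict (unitCube d))
  weak_grad : ∀ φ : EuclideanSpace ℝ (Fin d) → ℝ, IsTorusTest φ → ∀ i : Fin d,
    ∫ x in unitCube d, u x * gradient φ x i = - ∫ x in unitCube d, Du x i * φ x

/-- `u ∈ C^{0,α}(𝕋^d)` with Hölder constant `K` (for a periodic function, the Hölder condition for
the distance of the torus is the same as the one for the Euclidean distance of `ℝ^d`). -/
def IsTorusHolder {d : ℕ} (K α : ℝ) (u : EuclideanSpace ℝ (Fin d) → ℝ) : Prop :=
  TorusPeriodic u ∧ ∀ x y, |u x - u y| ≤ K * dist x y ^ α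

/-- A bounded measurable uniformly elliptic matrix field on the torus. -/
structure IsEllipticMatrix {d : ℕ} (θ₀ θ₁ Λ : ℝ)
    (A : EuclideanSpace ℝ (Fin d) → Matrix (Fin d) (Fin d) ℝ) : Prop where
  periodic : TorusPeriodic A
  measurable : ∀ i j, Measurable fun x => A x i j
  lower : ∀ x z, θ₀ * ‖z‖ ^ 2 ≤ matForm (A x) z z
  upper : ∀ x z, matForm (A x) z z ≤ θ₁ * ‖z‖ ^ 2
  bounded : ∀ x i j, |A x i j| ≤ Λ

/-- `g` is locally Lipschitz and `g(s) sign(s) ≥ C_g |s| - 1 / C_g`. -/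
structure IsCoupling (Cg : ℝ) (g : ℝ → ℝ) : Prop where
  locallyLipschitz : LocallyLipschitz g
  growth : ∀ s, Cg * |s| - 1 / Cg ≤ g s * Real.sign s

/-- `-div(A Duᵀ) + ½ Du A Duᵀ + V - H - g(-u) = 0` on the torus in the sense of distributions. -/
def IsWeakSolution {d : ℕ} (A : EuclideanSpace ℝ (Fin d) → Matrix (Fin d) (Fin d) ℝ)
    (V : EuclideanSpace ℝ (Fin d) → ℝ) (H : ℝ) (g : ℝ → ℝ)
    (u : EuclideanSpace ℝ (Fin d) → ℝ)
    (Du : EuclideanSpace ℝ (Fin d) → EuclideanSpace ℝ (Fin d)) : Prop :=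
  ∀ φ : EuclideanSpace ℝ (Fin d) → ℝ, IsTorusTest φ →
    ∫ x in unitCube d, (matForm (A x) (gradient φ x) (Du x)
      + (1 / 2 * matForm (A x) (Du x) (Du x) + (V x - H) - g (-u x)) * φ x) = 0

/-- The norm of the Morrey space `L^{p,lam}(𝕋^d)`, with values in `[0, ∞]`. -/
def torusMorreyNorm {d : ℕ} {F : Type*} [NormedAddCommGroup F] (p lam : ℝ)
    (f : EuclideanSpace ℝ (Fin d) → F) : ℝ≥0∞ :=
  ⨆ (x : EuclideanSpace ℝ (Fin d)) (r : ℝ) (_ : 0 < r),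
    ((ENNReal.ofReal (r ^ lam))⁻¹ * ∫⁻ y in unitCube d ∩ torusBall x r, ‖f y‖ₑ ^ p) ^ (1 / p)

/-- Membership in the Morrey space `L^{p,lam}(𝕋^d)`. -/
def MemTorusMorrey {d : ℕ} {F : Type*} [NormedAddCommGroup F] (p lam : ℝ)
    (f : EuclideanSpace ℝ (Fin d) → F) : Prop :=
  TorusPeriodic f ∧ IntegrableOn f (unitCube d) ∧ torusMorreyNorm p lam f < ⊤

end

/-! The engine is a Caccioppoli inequality. Test the equation with `η² (u - c)`, where `η` is a
cutoff at scale `r` and `c` lies below `u` on its support. Then `u - c ≥ 0`, so the quadratic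
gradient term `½ Du A Duᵀ` contributes with the same sign as the ellipticity term and can be
dropped. With `δ` the oscillation bound of `u` on the support, Young's inequality absorbs the cross
term and leaves `∫ η² |Du|² ≲ δ ∫ η² + δ² ∫ |Dη|²`. Hölder continuity gives `δ ~ r^α`, the cutoff
has `|Dη|² ≲ r⁻²`, and its support has volume `≲ r^d`. The right side is therefore `≲ r^(d+α) +
r^(d-2+2α)`, and the last power dominates for `r ≤ 1`. For `r ≥ 1` take `η = 1`: the global energy
bound suffices, because `λ > 0` makes `r^λ ≥ 1`.

The constants must not depend on `u`, so `g(-u)` has to be bounded a priori. Testing with `1` gives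
a point where `g(-u) ≥ V - H`. Testing with `exp(-u/2)`, which cancels the quadratic term as in the
Hopf–Cole transform, gives a point where `g(-u) ≤ V - H`. The growth of `g` bounds `u` from one side
at each of these points, and the Hölder bound spreads this to the whole torus.

The equation is given only for smooth test functions, while `Du A Duᵀ` is merely integrable. The
test functions `ζ ψ(u)` are reached by mollifying `u`: gradients converge almost everywhere, and by
Jensen they are dominated by the mollifications of `|Du|²`, whose integrals are constant. A
dominated convergence theorem with varying majorants (`tendsto_integral_of_dominated_by_convergent`)
passes to the limit in `IsWeakSolution.integrableOn_and_integral_comp_eq_zero`;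
`IsBoundedWeakSolution.caccioppoli` is the resulting estimate. -/

/-! ### The integer lattice and the unit cube as its fundamental domain -/

/-- The inclusion of the integer lattice in Euclidean space. -/
def integerVector (d : ℕ) : (Fin d → ℤ) →+ EuclideanSpace ℝ (Fin d) :=
  AddMonoidHom.mk' (fun k => WithLp.toLp 2 (fun i => (k i : ℝ))) (by
    intro a b; ext i; simp)

/-- The integer lattice of Euclidean space. -/
def integerLattice (d : ℕ) : AddSubgroup (EuclideanSpace ℝ (Fin d)) := (integerVector d).range

instance (d : ℕ) : Countable (integerLattice d) :=
  Set.Countable.to_subtype (by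
    have : ((integerLattice d : AddSubgroup _) : Set (EuclideanSpace ℝ (Fin d)))
      = Set.range (integerVector d) := rfl
    exact this ▸ Set.countable_range _)

@[simp] theorem integerVector_apply {d : ℕ} (k : Fin d → ℤ) (i : Fin d) :
    integerVector d k i = k i := rfl

theorem TorusPeriodic.apply_vadd {d : ℕ} {β : Type*} {f : EuclideanSpace ℝ (Fin d) → β}
    (hf : TorusPeriodic f) (l : integerLattice d) (x : EuclideanSpace ℝ (Fin d)) :
    f (l +ᵥ x) = f x := by
  obtain ⟨_, k, rfl⟩ := l
  rw [AddSubgroup.vadd_def, vadd_eq_add, add_comm]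
  exact hf k x

theorem TorusPeriodic.of_vadd {d : ℕ} {β : Type*} {f : EuclideanSpace ℝ (Fin d) → β}
    (hf : ∀ (l : integerLattice d) (x), f (l +ᵥ x) = f x) : TorusPeriodic f := by
  intro k x
  rw [add_comm]
  exact hf ⟨integerVector d k, k, rfl⟩ x

theorem TorusPeriodic.comp {d : ℕ} {β γ : Type*} {f : EuclideanSpace ℝ (Fin d) → β}
    (hf : TorusPeriodic f) (F : β → γ) : TorusPeriodic fun x => F (f x) :=
  fun k x => congrArg F (hf k x)

theorem TorusPeriodic.comp₂ {d : ℕ} {β γ δ : Type*} {f : EuclideanSpace ℝ (Fin d) → β}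
    {g : EuclideanSpace ℝ (Fin d) → γ}
    (hf : TorusPeriodic f) (hg : TorusPeriodic g) (F : β → γ → δ) :
    TorusPeriodic fun x => F (f x) (g x) :=
  fun k x => congrArg₂ F (hf k x) (hg k x)

theorem measurableSet_unitCube (d : ℕ) : MeasurableSet (unitCube d) := by
  have : unitCube d = ⋂ i, (fun x : EuclideanSpace ℝ (Fin d) => x i) ⁻¹' Set.Ico (0 : ℝ) 1 := by
    ext x; simp [unitCube]
  rw [this]
  exact MeasurableSet.iInter fun i => measurableSet_Ico.preimage (by fun_prop)

theorem volume_unitCube (d : ℕ) : volume (unitCube d) = 1 := by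
  have : unitCube d = (MeasurableEquiv.toLp 2 (Fin d → ℝ)).symm ⁻¹'
      (Set.pi Set.univ fun _ => Set.Ico (0 : ℝ) 1) := by
    ext x; simp [unitCube]
  rw [this, (EuclideanSpace.volume_preserving_symm_measurableEquiv_toLp (Fin d)).measure_preimage
    (MeasurableSet.univ_pi fun _ => measurableSet_Ico).nullMeasurableSet, Real.volume_pi_Ico]
  simp

instance isFiniteMeasure_restrict_unitCube (d : ℕ) :
    IsFiniteMeasure (volume.restrict (unitCube d)) :=
  ⟨by simp [volume_unitCube]⟩

theorem unitCube_subset_closedBall (d : ℕ) : unitCube d ⊆ Metric.closedBall 0 (√d) := by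
  intro x hx
  rw [mem_closedBall_zero_iff, EuclideanSpace.norm_eq]
  refine Real.sqrt_le_sqrt ?_
  calc ∑ i, ‖x i‖ ^ 2 ≤ ∑ _i : Fin d, (1 : ℝ) := by
        refine Finset.sum_le_sum fun i _ => ?_
        rw [Real.norm_eq_abs, sq_abs]
        have := hx i
        nlinarith [this.1, this.2]
    _ = d := by simp

theorem existsUnique_vadd_mem_unitCube {d : ℕ} (x : EuclideanSpace ℝ (Fin d)) :
    ∃! l : integerLattice d, l +ᵥ x ∈ unitCube d := by
  refine ⟨⟨integerVector d fun i => -⌊x i⌋, _, rfl⟩, ?_, ?_⟩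
  · intro i
    rw [AddSubgroup.vadd_def, vadd_eq_add, PiLp.add_apply, integerVector_apply]
    push_cast
    constructor <;> linarith [Int.floor_le (x i), Int.lt_floor_add_one (x i)]
  · rintro ⟨_, k, rfl⟩ h
    congr 2
    funext i
    have := h i
    rw [AddSubgroup.vadd_def, vadd_eq_add, PiLp.add_apply, integerVector_apply] at this
    have h2 : ⌊x i⌋ = -k i := by
      rw [Int.floor_eq_iff]
      push_cast
      constructor <;> linarith [this.1, this.2]
    lia

theorem isAddFundamentalDomain_unitCube (d : ℕ) :
    IsAddFundamentalDomain (integerLattice d) (unitCube d) volume :=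
  IsAddFundamentalDomain.mk' (measurableSet_unitCube d).nullMeasurableSet
    existsUnique_vadd_mem_unitCube

theorem isAddFundamentalDomain_preimage_add (d : ℕ) (y : EuclideanSpace ℝ (Fin d)) :
    IsAddFundamentalDomain (integerLattice d) ((fun x => x + y) ⁻¹' unitCube d) volume := by
  refine IsAddFundamentalDomain.mk'
    ((measurableSet_unitCube d).preimage (by fun_prop)).nullMeasurableSet fun x => ?_
  simpa only [Set.mem_preimage, AddSubgroup.vadd_def, vadd_eq_add, add_assoc] using
    existsUnique_vadd_mem_unitCube (x + y)

/-- The cube and its translates are all fundamental domains, so a periodic function has the same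
integral over each. -/
theorem TorusPeriodic.setLIntegral_add {d : ℕ} {f : EuclideanSpace ℝ (Fin d) → ℝ≥0∞}
    (hf : TorusPeriodic f) (y : EuclideanSpace ℝ (Fin d)) :
    ∫⁻ x in unitCube d, f (x + y) = ∫⁻ x in unitCube d, f x := by
  have h1 := (isAddFundamentalDomain_unitCube d).setLIntegral_eq
    (isAddFundamentalDomain_preimage_add d (-y)) f hf.apply_vadd
  rw [h1]
  have h2 := (measurePreserving_add_right (volume : Measure (EuclideanSpace ℝ (Fin d))) y)
    |>.setLIntegral_comp_preimage_emb (measurableEmbedding_addRight y) f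
      ((fun x => x + -y) ⁻¹' unitCube d)
  rw [← h2]
  congr 2
  ext x
  simp

theorem TorusPeriodic.locallyIntegrable {d : ℕ} {F : Type*} [NormedAddCommGroup F]
    {f : EuclideanSpace ℝ (Fin d) → F} (hf : TorusPeriodic f)
    (hi : IntegrableOn f (unitCube d)) : LocallyIntegrable f := by
  intro x
  -- The cube translated by `c` is centred at `x`, hence contains the ball of radius `1/2` around
  -- `x`.
  set c : EuclideanSpace ℝ (Fin d) := x - WithLp.toLp 2 fun _ => 1 / 2 with hc
  have h1 : IntegrableOn f ((fun z => z + -c) ⁻¹' unitCube d) :=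
    ((isAddFundamentalDomain_unitCube d).integrableOn_iff
      (isAddFundamentalDomain_preimage_add d (-c)) hf.apply_vadd).1 hi
  refine ⟨Metric.ball x (1 / 2), Metric.ball_mem_nhds x (by norm_num), h1.mono_set ?_⟩
  intro z hz i
  have h1 : |z i - x i| < 1 / 2 := by
    rw [Metric.mem_ball, dist_eq_norm] at hz
    exact lt_of_le_of_lt (by simpa using PiLp.norm_apply_le (z - x) i) hz
  rw [abs_lt] at h1
  have h2 : (z + -c) i = z i - x i + 1 / 2 := by
    rw [hc, PiLp.add_apply, PiLp.neg_apply, PiLp.sub_apply]; ring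
  rw [h2]
  constructor <;> linarith [h1.1, h1.2]

theorem integerLattice_finite_norm_le (d : ℕ) (R : ℝ) :
    {l : integerLattice d | ‖(l : EuclideanSpace ℝ (Fin d))‖ ≤ R}.Finite := by
  have h : (Set.pi Set.univ fun _ : Fin d => Set.Icc (-⌈R⌉) ⌈R⌉).Finite :=
    Set.Finite.pi fun _ => Set.finite_Icc _ _
  refine (h.image fun k => (⟨integerVector d k, k, rfl⟩ : integerLattice d)).subset ?_
  rintro ⟨_, k, rfl⟩ hk
  refine ⟨k, fun i _ => ?_, rfl⟩
  have h1 : |(k i : ℝ)| ≤ ⌈R⌉ :=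
    ((PiLp.norm_apply_le (integerVector d k) i).trans hk).trans (Int.le_ceil R)
  rw [abs_le] at h1
  exact ⟨by exact_mod_cast h1.1, by exact_mod_cast h1.2⟩

/-! ### Periodization and weak gradients against compactly supported functions -/

theorem gradient_apply {d : ℕ} (f : EuclideanSpace ℝ (Fin d) → ℝ) (x : EuclideanSpace ℝ (Fin d))
    (i : Fin d) : gradient f x i = fderiv ℝ f x (EuclideanSpace.single i 1) := by
  have h := InnerProductSpace.toDual_symm_apply (𝕜 := ℝ) (x := EuclideanSpace.single i (1 : ℝ))
    (y := fderiv ℝ f x)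
  rw [EuclideanSpace.inner_single_right] at h
  simpa [gradient] using h

/-- The sum of all integer translates of a function. -/
noncomputable def latticeSum {d : ℕ} (φ : EuclideanSpace ℝ (Fin d) → ℝ)
    (y : EuclideanSpace ℝ (Fin d)) : ℝ :=
  ∑' l : integerLattice d, φ (l +ᵥ y)

/-- On a bounded set only finitely many translates of a compactly supported function are nonzero,
and one finite index set serves the whole set. Smoothness and termwise differentiation of
`latticeSum` follow. -/
theorem latticeSum_eq_sum {d : ℕ} {φ : EuclideanSpace ℝ (Fin d) → ℝ} {R ρ : ℝ}
    (hφ : ∀ x, R < ‖x‖ → φ x = 0) {y : EuclideanSpace ℝ (Fin d)} (hy : ‖y‖ ≤ ρ) :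
    latticeSum φ y = ∑ l ∈ (integerLattice_finite_norm_le d (R + ρ)).toFinset, φ (l +ᵥ y) := by
  refine tsum_eq_sum fun l hl => hφ _ ?_
  simp only [Set.Finite.mem_toFinset, Set.mem_ofPred_eq, not_le] at hl
  rw [AddSubgroup.vadd_def, vadd_eq_add]
  have := norm_sub_norm_le (l : EuclideanSpace ℝ (Fin d)) (-y)
  rw [norm_neg, sub_neg_eq_add] at this
  linarith

theorem torusPeriodic_latticeSum {d : ℕ} (φ : EuclideanSpace ℝ (Fin d) → ℝ) :
    TorusPeriodic (latticeSum φ) := by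
  refine TorusPeriodic.of_vadd fun l x => ?_
  unfold latticeSum
  rw [← (Equiv.addRight l).tsum_eq (fun m : integerLattice d => φ (m +ᵥ x))]
  simp only [Equiv.coe_addRight, add_vadd]

theorem latticeSum_eventuallyEq {d : ℕ} {φ : EuclideanSpace ℝ (Fin d) → ℝ} {R ρ : ℝ}
    (hφ : ∀ x, R < ‖x‖ → φ x = 0) {y : EuclideanSpace ℝ (Fin d)} (hy : ‖y‖ < ρ) :
    latticeSum φ =ᶠ[nhds y] fun z =>
      ∑ l ∈ (integerLattice_finite_norm_le d (R + ρ)).toFinset, φ (l +ᵥ z) := by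
  filter_upwards [(isOpen_lt continuous_norm continuous_const).mem_nhds hy] with z hz
  exact latticeSum_eq_sum hφ (le_of_lt hz)

theorem contDiff_latticeSum {d : ℕ} {φ : EuclideanSpace ℝ (Fin d) → ℝ} {R : ℝ}
    (hφ : ∀ x, R < ‖x‖ → φ x = 0) (hs : ContDiff ℝ ∞ φ) : ContDiff ℝ ∞ (latticeSum φ) := by
  refine contDiff_iff_contDiffAt.2 fun y => ?_
  refine ContDiffAt.congr_of_eventuallyEq ?_ (latticeSum_eventuallyEq hφ (lt_add_one ‖y‖))
  refine ContDiffAt.sum fun l _ => ?_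
  exact (hs.comp (contDiff_const.add contDiff_id)).contDiffAt

theorem gradient_latticeSum {d : ℕ} {φ : EuclideanSpace ℝ (Fin d) → ℝ} {R : ℝ}
    (hφ : ∀ x, R < ‖x‖ → φ x = 0) (hs : ContDiff ℝ ∞ φ) (y : EuclideanSpace ℝ (Fin d))
    (i : Fin d) : gradient (latticeSum φ) y i = latticeSum (fun x => gradient φ x i) y := by
  have h0 : ∀ x, R < ‖x‖ → gradient φ x i = 0 := by
    intro x hx
    have : φ =ᶠ[nhds x] fun _ => (0 : ℝ) := by
      filter_upwards [(isOpen_lt continuous_const continuous_norm).mem_nhds hx] with z hz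
      exact hφ z hz
    rw [gradient_apply, this.fderiv_eq]
    simp
  rw [gradient_apply, (latticeSum_eventuallyEq hφ (lt_add_one ‖y‖)).fderiv_eq,
    latticeSum_eq_sum h0 (lt_add_one ‖y‖).le, fderiv_fun_sum]
  · rw [sum_apply]
    refine Finset.sum_congr rfl fun l _ => ?_
    rw [gradient_apply]
    have := fderiv_comp_add_left (𝕜 := ℝ) (f := φ) (x := y) (l : EuclideanSpace ℝ (Fin d))
    exact congrArg (fun T => T (EuclideanSpace.single i 1)) this
  · intro l _
    exact ((hs.comp (contDiff_const.add contDiff_id)).differentiable (by simp)).differentiableAt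

/-- Unfolding: cut the space into translates of the cube and move each piece back by periodicity of
`f`. The support condition makes the sum finite, so it commutes with the integral. -/
theorem TorusPeriodic.integral_mul_eq_setIntegral_latticeSum {d : ℕ}
    {f φ : EuclideanSpace ℝ (Fin d) → ℝ} (hf : TorusPeriodic f) (hi : IntegrableOn f (unitCube d))
    (hc : Continuous φ) {R : ℝ} (hφ : ∀ x, R < ‖x‖ → φ x = 0) :
    ∫ x, f x * φ x = ∫ x in unitCube d, f x * latticeSum φ x := by
  have hl := hf.locallyIntegrable hi
  have hcs : HasCompactSupport φ := HasCompactSupport.of_support_subset_isCompact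
    (isCompact_closedBall 0 R) fun x hx => by
      rw [mem_closedBall_zero_iff]
      by_contra h
      exact hx (hφ x (not_le.1 h))
  have hint : ∀ l : integerLattice d, Integrable fun x => f x * φ (l +ᵥ x) := fun l =>
    hl.integrable_smul_right_of_hasCompactSupport (hc.comp (continuous_const.add continuous_id))
      (hcs.comp_homeomorph (Homeomorph.addLeft (l : EuclideanSpace ℝ (Fin d))))
  rw [(isAddFundamentalDomain_unitCube d).integral_eq_tsum'' (fun x => f x * φ x)
    (hl.integrable_smul_right_of_hasCompactSupport hc hcs)]
  simp only [hf.apply_vadd]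
  have hy : ∀ x ∈ unitCube d, ‖x‖ ≤ √d := fun x hx => by
    simpa using unitCube_subset_closedBall d hx
  rw [tsum_eq_sum (s := (integerLattice_finite_norm_le d (R + √d)).toFinset),
    ← integral_finsetSum _ fun l _ => (hint l).integrableOn]
  · refine setIntegral_congr_fun (measurableSet_unitCube d) fun x hx => ?_
    simp only [latticeSum_eq_sum hφ (hy x hx), Finset.mul_sum]
  · intro l hl
    simp only [Set.Finite.mem_toFinset, Set.mem_ofPred_eq, not_le] at hl
    refine setIntegral_eq_zero_of_forall_eq_zero fun x hx => ?_
    rw [hφ, mul_zero]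
    rw [AddSubgroup.vadd_def, vadd_eq_add]
    have := norm_sub_norm_le (l : EuclideanSpace ℝ (Fin d)) (-x)
    rw [norm_neg, sub_neg_eq_add] at this
    linarith [hy x hx]

theorem MeasureTheory.MemLp.euclidean_apply {d : ℕ} {X : Type*} [MeasurableSpace X] {μ : Measure X}
    {p : ℝ≥0∞} {f : X → EuclideanSpace ℝ (Fin d)} (hf : MemLp f p μ) (i : Fin d) :
    MemLp (fun x => f x i) p μ :=
  (EuclideanSpace.proj i : EuclideanSpace ℝ (Fin d) →L[ℝ] ℝ).comp_memLp' hf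

/-- Mollifiers are compactly supported, not periodic. The weak gradient identity transfers to them
by testing with their periodization. -/
theorem IsTorusH1.integral_mul_gradient {d : ℕ} {u : EuclideanSpace ℝ (Fin d) → ℝ}
    {Du : EuclideanSpace ℝ (Fin d) → EuclideanSpace ℝ (Fin d)} (hu : IsTorusH1 u Du)
    {φ : EuclideanSpace ℝ (Fin d) → ℝ} (hs : ContDiff ℝ ∞ φ) (hc : HasCompactSupport φ)
    (i : Fin d) : ∫ x, u x * gradient φ x i = -∫ x, Du x i * φ x := by
  obtain ⟨R, hR⟩ := hc.isCompact.isBounded.subset_closedBall 0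
  have hφ : ∀ x, R < ‖x‖ → φ x = 0 := fun x hx => by
    by_contra h
    have := hR (subset_tsupport φ h)
    rw [mem_closedBall_zero_iff] at this
    linarith
  have h0 : ∀ x, R < ‖x‖ → gradient φ x i = 0 := by
    intro x hx
    have : φ =ᶠ[nhds x] fun _ => (0 : ℝ) := by
      filter_upwards [(isOpen_lt continuous_const continuous_norm).mem_nhds hx] with z hz
      exact hφ z hz
    rw [gradient_apply, this.fderiv_eq]
    simp
  have hg : Continuous fun x => gradient φ x i := by
    simp only [gradient_apply]
    exact (hs.continuous_fderiv (by simp)).clm_apply continuous_const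
  rw [hu.periodic.integral_mul_eq_setIntegral_latticeSum (hu.memLp.integrable (by norm_num)) hg h0,
    (hu.periodic_grad.comp fun v => v i).integral_mul_eq_setIntegral_latticeSum
      ((hu.memLp_grad.euclidean_apply i).integrable (by norm_num)) hs.continuous hφ,
    ← hu.weak_grad _ ⟨contDiff_latticeSum hφ hs, torusPeriodic_latticeSum φ⟩ i]
  simp only [gradient_latticeSum hφ hs]

/-! ### Mollification on the torus -/

open scoped Convolution

theorem TorusPeriodic.convolution {d : ℕ} {F : Type*} [NormedAddCommGroup F] [NormedSpace ℝ F]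
    {f : EuclideanSpace ℝ (Fin d) → F} (hf : TorusPeriodic f) (ρ : EuclideanSpace ℝ (Fin d) → ℝ) :
    TorusPeriodic (ρ ⋆[ContinuousLinearMap.lsmul ℝ ℝ, volume] f) := by
  intro k x
  rw [convolution_def, convolution_def]
  congr 1 with t
  have := hf k (x - t)
  rw [add_sub_right_comm, this]

/-- The derivative falls on `ρ`. The reflection `t ↦ ρ (x - t)` is then a test function for the weak
gradient, and its sign change cancels the one from integration by parts. -/
theorem IsTorusH1.gradient_convolution {d : ℕ} {u : EuclideanSpace ℝ (Fin d) → ℝ}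
    {Du : EuclideanSpace ℝ (Fin d) → EuclideanSpace ℝ (Fin d)} (hu : IsTorusH1 u Du)
    {ρ : EuclideanSpace ℝ (Fin d) → ℝ} (hs : ContDiff ℝ ∞ ρ) (hc : HasCompactSupport ρ)
    (x : EuclideanSpace ℝ (Fin d)) :
    gradient (ρ ⋆[ContinuousLinearMap.lsmul ℝ ℝ, volume] u) x
      = (ρ ⋆[ContinuousLinearMap.lsmul ℝ ℝ, volume] Du) x := by
  have hlu := hu.periodic.locallyIntegrable (hu.memLp.integrable (by norm_num))
  have hlD := hu.periodic_grad.locallyIntegrable (hu.memLp_grad.integrable (by norm_num))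
  ext i
  have h1 := hc.hasFDerivAt_convolution_left (μ := volume) (ContinuousLinearMap.lsmul ℝ ℝ)
    (hs.of_le (by simp)) hlu x
  have hex : ConvolutionExistsAt (fderiv ℝ ρ) u x
      ((ContinuousLinearMap.lsmul ℝ ℝ).precompL (EuclideanSpace ℝ (Fin d))) volume :=
    (hc.fderiv ℝ).convolutionExists_left _ (hs.continuous_fderiv (by simp)) hlu x
  have hexD : ConvolutionExistsAt ρ Du x (ContinuousLinearMap.lsmul ℝ ℝ) volume :=
    hc.convolutionExists_left _ hs.continuous hlD x
  have hφ : ContDiff ℝ ∞ fun t => ρ (x - t) := hs.comp (contDiff_const.sub contDiff_id)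
  have hgrad : ∀ t, gradient (fun t => ρ (x - t)) t i
      = -(fderiv ℝ ρ (x - t) (EuclideanSpace.single i 1)) := by
    intro t
    have h : HasFDerivAt (fun t => ρ (x - t)) _ t :=
      ((hs.differentiable (by simp)).differentiableAt (x := x - t)).hasFDerivAt.comp t
        ((hasFDerivAt_id t).const_sub x)
    rw [gradient_apply, h.fderiv]
    simp
  have key := hu.integral_mul_gradient hφ
    (hc.comp_homeomorph (Homeomorph.subLeft x)) i
  simp only [hgrad, mul_neg, integral_neg, neg_inj] at key
  rw [gradient_apply, h1.fderiv, convolution_eq_swap, convolution_eq_swap,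
    ContinuousLinearMap.integral_apply hex.integrable_swap]
  have h2 := (EuclideanSpace.proj i : EuclideanSpace ℝ (Fin d) →L[ℝ] ℝ).integral_comp_comm
    hexD.integrable_swap
  refine Eq.trans ?_ (key.trans (Eq.trans ?_ h2))
  · refine integral_congr_ae (Filter.Eventually.of_forall fun t => ?_)
    simp [ContinuousLinearMap.precompL_apply, mul_comm]
  · refine integral_congr_ae (Filter.Eventually.of_forall fun t => ?_)
    simp [mul_comm]

/-- Jensen's inequality for the probability density `ρ`: with `v` the average, write `‖v‖²` as the
average of `⟪v, f (x - t)⟫`, which is at most `½ ‖v‖² + ½` the average of `‖f‖²`. -/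
theorem norm_convolution_sq_le {d : ℕ} {f : EuclideanSpace ℝ (Fin d) → EuclideanSpace ℝ (Fin d)}
    {ρ : EuclideanSpace ℝ (Fin d) → ℝ} (hρ : Continuous ρ) (hc : HasCompactSupport ρ)
    (h0 : ∀ x, 0 ≤ ρ x) (h1 : ∫ x, ρ x = 1) (hf : LocallyIntegrable f)
    (hf2 : LocallyIntegrable fun x => ‖f x‖ ^ 2) (x : EuclideanSpace ℝ (Fin d)) :
    ‖(ρ ⋆[ContinuousLinearMap.lsmul ℝ ℝ, volume] f) x‖ ^ 2
      ≤ (ρ ⋆[ContinuousLinearMap.lsmul ℝ ℝ, volume] fun x => ‖f x‖ ^ 2) x := by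
  have hex : Integrable fun t => ρ t • f (x - t) :=
    hc.convolutionExists_left (ContinuousLinearMap.lsmul ℝ ℝ) hρ hf x
  have hex2 : Integrable fun t => ρ t • ‖f (x - t)‖ ^ 2 :=
    hc.convolutionExists_left (ContinuousLinearMap.lsmul ℝ ℝ) hρ hf2 x
  have hint : Integrable ρ := hρ.integrable_of_hasCompactSupport hc
  set v := (ρ ⋆[ContinuousLinearMap.lsmul ℝ ℝ, volume] f) x with hv
  have hv' : v = ∫ t, ρ t • f (x - t) := rfl
  have e1 : ‖v‖ ^ 2 = ∫ t, inner ℝ v (ρ t • f (x - t)) := by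
    rw [integral_inner hex, ← hv', real_inner_self_eq_norm_sq]
  have e2 : ∫ t, inner ℝ v (ρ t • f (x - t))
      ≤ ∫ t, ((1 / 2) * (ρ t • ‖f (x - t)‖ ^ 2) + (1 / 2) * ‖v‖ ^ 2 * ρ t) := by
    refine integral_mono (hex.const_inner v)
      ((hex2.const_mul _).add (hint.const_mul _)) fun t => ?_
    simp only [inner_smul_right, smul_eq_mul]
    have := real_inner_le_norm v (f (x - t))
    nlinarith [mul_le_mul_of_nonneg_left this (h0 t),
      mul_nonneg (h0 t) (sq_nonneg (‖v‖ - ‖f (x - t)‖))]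
  rw [integral_add (hex2.const_mul _) (hint.const_mul _), integral_const_mul, integral_const_mul,
    h1, ← e1] at e2
  have e3 : (ρ ⋆[ContinuousLinearMap.lsmul ℝ ℝ, volume] fun x => ‖f x‖ ^ 2) x
    = ∫ t, ρ t • ‖f (x - t)‖ ^ 2 := rfl
  rw [e3]
  linarith

/-- Tonelli and translation invariance of integrals over the cube. It is what keeps the integrals of
the majorants constant along the mollification. -/
theorem TorusPeriodic.setIntegral_convolution {d : ℕ} {f : EuclideanSpace ℝ (Fin d) → ℝ}
    (hf : TorusPeriodic f) (hi : IntegrableOn f (unitCube d)) (hf0 : ∀ x, 0 ≤ f x)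
    {ρ : EuclideanSpace ℝ (Fin d) → ℝ} (hρ : Continuous ρ) (hc : HasCompactSupport ρ)
    (h0 : ∀ x, 0 ≤ ρ x) (h1 : ∫ x, ρ x = 1) :
    ∫ x in unitCube d, (ρ ⋆[ContinuousLinearMap.lsmul ℝ ℝ, volume] f) x
      = ∫ x in unitCube d, f x := by
  have hl := hf.locallyIntegrable hi
  have hcont : Continuous (ρ ⋆[ContinuousLinearMap.lsmul ℝ ℝ, volume] f) :=
    hc.continuous_convolution_left _ hρ hl
  have hex : ∀ x, Integrable fun t => ρ t • f (x - t) := fun x =>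
    hc.convolutionExists_left (ContinuousLinearMap.lsmul ℝ ℝ) hρ hl x
  have hnn : ∀ x, 0 ≤ (ρ ⋆[ContinuousLinearMap.lsmul ℝ ℝ, volume] f) x := fun x =>
    integral_nonneg fun t => mul_nonneg (h0 t) (hf0 _)
  rw [integral_eq_lintegral_of_nonneg_ae (Filter.Eventually.of_forall hnn)
    hcont.aestronglyMeasurable, integral_eq_lintegral_of_nonneg_ae (Filter.Eventually.of_forall hf0)
    hi.aestronglyMeasurable]
  congr 1
  have e1 : ∀ x, ENNReal.ofReal ((ρ ⋆[ContinuousLinearMap.lsmul ℝ ℝ, volume] f) x)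
      = ∫⁻ t, ENNReal.ofReal (ρ t) * ENNReal.ofReal (f (x - t)) := by
    intro x
    refine (ofReal_integral_eq_lintegral_ofReal (hex x)
      (Filter.Eventually.of_forall fun t => mul_nonneg (h0 t) (hf0 _))).trans ?_
    refine lintegral_congr fun t => ?_
    rw [smul_eq_mul, ENNReal.ofReal_mul (h0 t)]
  simp only [e1]
  have hm : AEMeasurable (fun p : EuclideanSpace ℝ (Fin d) × EuclideanSpace ℝ (Fin d) =>
      ENNReal.ofReal (ρ p.2) * ENNReal.ofReal (f (p.1 - p.2)))
      ((volume.restrict (unitCube d)).prod volume) := by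
    have h2 : AEMeasurable (fun p : EuclideanSpace ℝ (Fin d) × EuclideanSpace ℝ (Fin d) =>
        f (p.1 - p.2)) ((volume : Measure (EuclideanSpace ℝ (Fin d))).prod volume) :=
      hl.aestronglyMeasurable.aemeasurable.comp_quasiMeasurePreserving
        (quasiMeasurePreserving_sub_of_right_invariant volume volume)
    have h3 : (volume : Measure (EuclideanSpace ℝ (Fin d))).restrict (unitCube d) ≪ volume :=
      Measure.restrict_le_self.absolutelyContinuous
    exact ((hρ.measurable.comp measurable_snd).ennreal_ofReal.aemeasurable).mul
      (h2.mono_ac (h3.prod Measure.AbsolutelyContinuous.rfl)).ennreal_ofReal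
  rw [lintegral_lintegral_swap hm]
  have e2 : ∀ t, ∫⁻ x in unitCube d, ENNReal.ofReal (ρ t) * ENNReal.ofReal (f (x - t))
      = ENNReal.ofReal (ρ t) * ∫⁻ x in unitCube d, ENNReal.ofReal (f x) := by
    intro t
    rw [lintegral_const_mul' _ _ ENNReal.ofReal_ne_top]
    congr 1
    simpa only [sub_eq_add_neg] using (hf.comp ENNReal.ofReal).setLIntegral_add (-t)
  simp only [e2]
  rw [lintegral_mul_const _ hρ.measurable.ennreal_ofReal,
    ← ofReal_integral_eq_lintegral_ofReal (hρ.integrable_of_hasCompactSupport hc)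
      (Filter.Eventually.of_forall h0), h1, ENNReal.ofReal_one, one_mul]

theorem Continuous.integrableOn_unitCube {d : ℕ} {f : EuclideanSpace ℝ (Fin d) → ℝ}
    (hf : Continuous f) : IntegrableOn f (unitCube d) :=
  (hf.continuousOn.integrableOn_compact (isCompact_closedBall 0 (√d))).mono_set
    (unitCube_subset_closedBall d)

open Filter Topology in
/-- Mollification: a bounded continuous function of the Sobolev space of the torus is the limit of
smooth functions whose gradients converge almost everywhere and are dominated by a sequence
converging in mean. -/
theorem IsTorusH1.exists_smooth_approximation {d : ℕ} {u : EuclideanSpace ℝ (Fin d) → ℝ}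
    {Du : EuclideanSpace ℝ (Fin d) → EuclideanSpace ℝ (Fin d)} (hu : IsTorusH1 u Du)
    (hcont : Continuous u) {M : ℝ} (hM : ∀ x, |u x| ≤ M) :
    ∃ (v : ℕ → EuclideanSpace ℝ (Fin d) → ℝ) (f : ℕ → EuclideanSpace ℝ (Fin d) → ℝ),
      (∀ n, IsTorusTest (v n)) ∧ (∀ n x, |v n x| ≤ 3 * M) ∧
      (∀ x, Tendsto (fun n => v n x) atTop (𝓝 (u x))) ∧
      (∀ᵐ x, Tendsto (fun n => gradient (v n) x) atTop (𝓝 (Du x))) ∧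
      (∀ n x, ‖gradient (v n) x‖ ^ 2 ≤ f n x) ∧
      (∀ n, IntegrableOn (f n) (unitCube d)) ∧
      (∀ᵐ x, Tendsto (fun n => f n x) atTop (𝓝 (‖Du x‖ ^ 2))) ∧
      ∀ n, ∫ x in unitCube d, f n x = ∫ x in unitCube d, ‖Du x‖ ^ 2 := by
  -- Both radii shrink to zero with fixed ratio `2`; the bounded ratio is needed for almost
  -- everywhere convergence of the mollifications.
  let φ : ℕ → ContDiffBump (0 : EuclideanSpace ℝ (Fin d)) := fun n =>
    ⟨1 / (n + 1), 2 * (1 / (n + 1)), by positivity, by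
      have : (0 : ℝ) < 1 / (n + 1) := by positivity
      linarith⟩
  have hφ0 : Tendsto (fun n => (φ n).rOut) atTop (𝓝 0) := by
    have := (tendsto_one_div_add_atTop_nhds_zero_nat (𝕜 := ℝ)).const_mul 2
    rwa [mul_zero] at this
  have hφ1 : ∀ᶠ n in atTop, (φ n).rOut ≤ 2 * (φ n).rIn := Eventually.of_forall fun n => le_rfl
  have hiD : IntegrableOn Du (unitCube d) := hu.memLp_grad.integrable (by norm_num)
  have hiD2 : IntegrableOn (fun x => ‖Du x‖ ^ 2) (unitCube d) :=
    hu.memLp_grad.integrable_norm_pow (by norm_num)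
  have hpD2 : TorusPeriodic fun x => ‖Du x‖ ^ 2 := hu.periodic_grad.comp fun v => ‖v‖ ^ 2
  have hlu := hu.periodic.locallyIntegrable (hu.memLp.integrable (by norm_num))
  have hlD := hu.periodic_grad.locallyIntegrable hiD
  have hlD2 := hpD2.locallyIntegrable hiD2
  have hρs : ∀ n, ContDiff ℝ ∞ ((φ n).normed volume) := fun n => (φ n).contDiff_normed
  have hρc : ∀ n, HasCompactSupport ((φ n).normed volume) := fun n =>
    (φ n).hasCompactSupport_normed
  refine ⟨fun n => (φ n).normed volume ⋆[ContinuousLinearMap.lsmul ℝ ℝ, volume] u,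
    fun n => (φ n).normed volume ⋆[ContinuousLinearMap.lsmul ℝ ℝ, volume] fun x => ‖Du x‖ ^ 2,
    fun n => ⟨(hρc n).contDiff_convolution_left _ (hρs n) hlu, hu.periodic.convolution _⟩,
    fun n x => ?_, fun x => ?_, ?_, fun n x => ?_, fun n => ?_, ?_, fun n => ?_⟩
  -- The crude bound `3 M` comes from `|v - u| ≤ 2 M` and `|u| ≤ M`; only uniformity in `n` matters.
  · have h1 := (φ n).dist_normed_convolution_le (μ := volume) (g := u) (x₀ := x) (ε := 2 * M)
      hcont.aestronglyMeasurable fun y _ => by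
        rw [Real.dist_eq]
        have := abs_sub (u y) (u x)
        linarith [hM x, hM y]
    rw [Real.dist_eq] at h1
    have h2 := hM x
    rw [abs_le] at *
    constructor <;> linarith [h1.1, h1.2]
  · exact ContDiffBump.convolution_tendsto_right_of_continuous hφ0 hcont x
  · filter_upwards [ContDiffBump.ae_convolution_tendsto_right_of_locallyIntegrable (μ := volume)
      hφ0 hφ1 hlD] with x hx
    simpa only [hu.gradient_convolution (hρs _) (hρc _)] using hx
  · rw [hu.gradient_convolution (hρs n) (hρc n)]
    exact norm_convolution_sq_le (hρs n).continuous (hρc n) (φ n).nonneg_normed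
      (φ n).integral_normed hlD hlD2 x
  · exact ((hρc n).continuous_convolution_left _ (hρs n).continuous hlD2).integrableOn_unitCube
  · exact ContDiffBump.ae_convolution_tendsto_right_of_locallyIntegrable hφ0 hφ1 hlD2
  · exact hpD2.setIntegral_convolution hiD2 (fun x => sq_nonneg _) (hρs n).continuous (hρc n)
      (φ n).nonneg_normed (φ n).integral_normed

/-! ### Passing to the limit: nonlinear test functions -/

open Filter Topology in
/-- A generalized dominated convergence theorem, in which the dominating function varies. -/
theorem tendsto_integral_of_dominated_by_convergent {X : Type*} [MeasurableSpace X] {μ : Measure X}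
    {F G : ℕ → X → ℝ} {F₀ G₀ : X → ℝ} (hF : ∀ n, AEStronglyMeasurable (F n) μ)
    (hG : ∀ n, Integrable (G n) μ) (hG₀ : Integrable G₀ μ) (hFG : ∀ n, ∀ᵐ x ∂μ, |F n x| ≤ G n x)
    (hFl : ∀ᵐ x ∂μ, Tendsto (fun n => F n x) atTop (𝓝 (F₀ x)))
    (hGl : ∀ᵐ x ∂μ, Tendsto (fun n => G n x) atTop (𝓝 (G₀ x)))
    (hGi : Tendsto (fun n => ∫ x, G n x ∂μ) atTop (𝓝 (∫ x, G₀ x ∂μ))) :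
    Integrable F₀ μ ∧ Tendsto (fun n => ∫ x, F n x ∂μ) atTop (𝓝 (∫ x, F₀ x ∂μ)) := by
  have hFG' : ∀ᵐ x ∂μ, ∀ n, |F n x| ≤ G n x := ae_all_iff.2 hFG
  have hFi : ∀ n, Integrable (F n) μ := fun n => (hG n).mono' (hF n) (hFG n)
  have hF₀G₀ : ∀ᵐ x ∂μ, |F₀ x| ≤ |G₀ x| := by
    filter_upwards [hFl, hGl, hFG'] with x h1 h2 h3
    exact (le_of_tendsto_of_tendsto' h1.abs h2 h3).trans (le_abs_self _)
  refine ⟨hG₀.abs.mono' (aestronglyMeasurable_of_tendsto_ae atTop hF hFl) hF₀G₀, ?_⟩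
  -- Since `G n ≥ |F n| ≥ 0`, the positive part of `G₀ - G n` is dominated by `|G₀|`.
  have hpos : Tendsto (fun n => ∫ x, max (G₀ x - G n x) 0 ∂μ) atTop (𝓝 (∫ _x, (0 : ℝ) ∂μ)) := by
    refine tendsto_integral_of_dominated_convergence (fun x => |G₀ x|)
      (fun n => ((hG₀.sub (hG n)).pos_part).aestronglyMeasurable) hG₀.abs (fun n => ?_) ?_
    · filter_upwards [hFG n] with x hx
      rw [Real.norm_eq_abs, abs_of_nonneg (le_max_right _ _)]
      exact max_le (by linarith [le_abs_self (G₀ x), abs_nonneg (F n x)]) (abs_nonneg _)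
    · filter_upwards [hGl] with x hx
      have := (hx.const_sub (G₀ x)).max (tendsto_const_nhds (x := (0 : ℝ)))
      rwa [sub_self, max_self] at this
  -- Scheffé's argument: `|a| = a + 2 max (-a) 0` reduces `L¹` convergence of `G n` to convergence
  -- of integrals and `hpos`.
  have hdiff : Tendsto (fun n => ∫ x, |G n x - G₀ x| ∂μ) atTop (𝓝 0) := by
    have h : ∀ n, ∫ x, |G n x - G₀ x| ∂μ
        = (∫ x, G n x ∂μ - ∫ x, G₀ x ∂μ) + 2 * ∫ x, max (G₀ x - G n x) 0 ∂μ := by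
      intro n
      have i1 : Integrable (fun x => G n x - G₀ x) μ := (hG n).sub hG₀
      have i2 : Integrable (fun x => 2 * max (G₀ x - G n x) 0) μ :=
        ((hG₀.sub (hG n)).pos_part).const_mul 2
      rw [← integral_sub (hG n) hG₀, ← integral_const_mul, ← integral_add i1 i2]
      refine integral_congr_ae (Eventually.of_forall fun x => ?_)
      simp only
      rcases le_total (G n x) (G₀ x) with h | h
      · rw [abs_of_nonpos (by linarith), max_eq_left (by linarith)]; ring
      · rw [abs_of_nonneg (by linarith), max_eq_right (by linarith)]; ring
    simp only [h]
    have := (hGi.sub_const (∫ x, G₀ x ∂μ)).add (hpos.const_mul 2)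
    simpa using this
  -- Truncating `F n` to `[-|G₀|, |G₀|]` allows ordinary dominated convergence; the part cut off is
  -- at most `|G n - G₀|`.
  have hclipi : ∀ n, Integrable (fun x => max (-|G₀ x|) (min (F n x) |G₀ x|)) μ := fun n =>
    hG₀.abs.neg.sup ((hFi n).inf hG₀.abs)
  have hclip : Tendsto (fun n => ∫ x, max (-|G₀ x|) (min (F n x) |G₀ x|) ∂μ) atTop
      (𝓝 (∫ x, F₀ x ∂μ)) := by
    refine tendsto_integral_of_dominated_convergence (fun x => |G₀ x|)
      (fun n => (hclipi n).aestronglyMeasurable) hG₀.abs (fun n => ?_) ?_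
    · refine Eventually.of_forall fun x => ?_
      rw [Real.norm_eq_abs, abs_le]
      exact ⟨le_max_left _ _, max_le (by linarith [abs_nonneg (G₀ x)]) (min_le_right _ _)⟩
    · filter_upwards [hFl, hF₀G₀] with x h1 h4
      have h5 := (tendsto_const_nhds (x := -|G₀ x|)).max (h1.min (tendsto_const_nhds (x := |G₀ x|)))
      rw [abs_le] at h4
      rwa [min_eq_left h4.2, max_eq_right h4.1] at h5
  have hrest : Tendsto (fun n => ∫ x, (F n x - max (-|G₀ x|) (min (F n x) |G₀ x|)) ∂μ) atTop
      (𝓝 0) := by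
    refine squeeze_zero_norm (fun n => ?_) hdiff
    refine (norm_integral_le_integral_norm _).trans
      (integral_mono_ae ((hFi n).sub (hclipi n)).norm ((hG n).sub hG₀).abs ?_)
    filter_upwards [hFG n] with x hx
    simp only [Real.norm_eq_abs]
    have h1 : G n x - |G₀ x| ≤ |G n x - G₀ x| := by
      have := abs_sub_abs_le_abs_sub (G n x) (G₀ x)
      linarith [le_abs_self (G n x)]
    rw [abs_le] at hx
    have h0 := abs_nonneg (G₀ x)
    rcases le_total (F n x) |G₀ x| with h | h
    · rw [min_eq_left h]
      rcases le_total (-|G₀ x|) (F n x) with h' | h'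
      · rw [max_eq_right h', sub_self, abs_zero]; exact abs_nonneg _
      · rw [max_eq_left h', abs_of_nonpos (by linarith)]; linarith [hx.1]
    · rw [min_eq_right h, max_eq_right (by linarith), abs_of_nonneg (by linarith)]
      linarith [hx.2]
  have := hrest.add hclip
  rw [zero_add] at this
  refine this.congr fun n => ?_
  rw [integral_sub (hFi n) (hclipi n)]
  ring

theorem TorusPeriodic.exists_norm_le {d : ℕ} {F : Type*} [NormedAddCommGroup F]
    {f : EuclideanSpace ℝ (Fin d) → F} (hf : TorusPeriodic f) (hc : Continuous f) :
    ∃ M, 0 ≤ M ∧ ∀ x, ‖f x‖ ≤ M := by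
  obtain ⟨M, hM⟩ := (isCompact_closedBall (0 : EuclideanSpace ℝ (Fin d)) (√d)).exists_bound_of_continuousOn
    hc.continuousOn
  refine ⟨max M 0, le_max_right _ _, fun x => ?_⟩
  obtain ⟨l, hl, -⟩ := existsUnique_vadd_mem_unitCube x
  rw [← hf.apply_vadd l x]
  exact (hM _ (unitCube_subset_closedBall d hl)).trans (le_max_left _ _)

theorem continuous_gradient {d : ℕ} {f : EuclideanSpace ℝ (Fin d) → ℝ} (hf : ContDiff ℝ ∞ f) :
    Continuous (gradient f) :=
  (InnerProductSpace.toDual ℝ (EuclideanSpace ℝ (Fin d))).symm.continuous.comp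
    (hf.continuous_fderiv (by simp))

theorem TorusPeriodic.gradient {d : ℕ} {f : EuclideanSpace ℝ (Fin d) → ℝ} (hf : TorusPeriodic f) :
    TorusPeriodic (gradient f) := by
  intro k x
  unfold _root_.gradient
  rw [← fderiv_comp_add_right]
  congr 2
  funext y
  exact hf k y

theorem gradient_mul_comp {d : ℕ} {ζ v : EuclideanSpace ℝ (Fin d) → ℝ} {ψ : ℝ → ℝ}
    (hζ : ContDiff ℝ ∞ ζ) (hv : ContDiff ℝ ∞ v) (hψ : ContDiff ℝ ∞ ψ)
    (x : EuclideanSpace ℝ (Fin d)) :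
    gradient (fun y => ζ y * ψ (v y)) x
      = ψ (v x) • gradient ζ x + (ζ x * deriv ψ (v x)) • gradient v x := by
  have h1 := ((hζ.differentiable (by simp)) x).hasFDerivAt
  have h2 := ((hv.differentiable (by simp)) x).hasFDerivAt
  have h3 := ((hψ.differentiable (by simp)) (v x)).hasDerivAt
  have h4 := h1.mul (h3.comp_hasFDerivAt x h2)
  ext i
  rw [gradient_apply, PiLp.add_apply, PiLp.smul_apply, PiLp.smul_apply, gradient_apply,
    gradient_apply]
  have h5 : fderiv ℝ (fun y => ζ y * ψ (v y)) x = _ := h4.fderiv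
  rw [h5]
  simp
  ring

theorem matForm_add_left {d : ℕ} (M : Matrix (Fin d) (Fin d) ℝ) (p p' q : EuclideanSpace ℝ (Fin d)) :
    matForm M (p + p') q = matForm M p q + matForm M p' q := by
  simp only [matForm, PiLp.add_apply, add_mul, Finset.sum_add_distrib]

theorem matForm_smul_left {d : ℕ} (M : Matrix (Fin d) (Fin d) ℝ) (c : ℝ)
    (p q : EuclideanSpace ℝ (Fin d)) : matForm M (c • p) q = c * matForm M p q := by
  simp only [matForm, PiLp.smul_apply, smul_eq_mul, Finset.mul_sum]
  exact Finset.sum_congr rfl fun i _ => Finset.sum_congr rfl fun j _ => by ring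

theorem continuous_matForm_left {d : ℕ} (M : Matrix (Fin d) (Fin d) ℝ)
    (q : EuclideanSpace ℝ (Fin d)) : Continuous fun p => matForm M p q := by
  unfold matForm
  fun_prop

theorem abs_matForm_le {d : ℕ} {M : Matrix (Fin d) (Fin d) ℝ} {Λ : ℝ} (hM : ∀ i j, |M i j| ≤ Λ)
    (hΛ : 0 ≤ Λ) (p q : EuclideanSpace ℝ (Fin d)) : |matForm M p q| ≤ (d : ℝ) ^ 2 * Λ * ‖p‖ * ‖q‖ := by
  calc |matForm M p q| ≤ ∑ i, ∑ j, |p i * M i j * q j| :=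
        (Finset.abs_sum_le_sum_abs _ _).trans
          (Finset.sum_le_sum fun i _ => Finset.abs_sum_le_sum_abs _ _)
    _ ≤ ∑ _i : Fin d, ∑ _j : Fin d, ‖p‖ * Λ * ‖q‖ := by
        refine Finset.sum_le_sum fun i _ => Finset.sum_le_sum fun j _ => ?_
        rw [abs_mul, abs_mul]
        exact mul_le_mul (mul_le_mul (PiLp.norm_apply_le p i) (hM i j) (abs_nonneg _)
          (norm_nonneg _)) (PiLp.norm_apply_le q j) (abs_nonneg _)
          (mul_nonneg (norm_nonneg _) hΛ)
    _ = (d : ℝ) ^ 2 * Λ * ‖p‖ * ‖q‖ := by simp; ring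

theorem aestronglyMeasurable_matForm {d : ℕ} {X : Type*} [MeasurableSpace X] {μ : Measure X}
    {A : X → Matrix (Fin d) (Fin d) ℝ} (hA : ∀ i j, Measurable fun x => A x i j)
    {p q : X → EuclideanSpace ℝ (Fin d)} (hp : AEStronglyMeasurable p μ)
    (hq : AEStronglyMeasurable q μ) : AEStronglyMeasurable (fun x => matForm (A x) (p x) (q x)) μ := by
  have hproj : ∀ (i : Fin d) {r : X → EuclideanSpace ℝ (Fin d)}, AEStronglyMeasurable r μ →
      AEStronglyMeasurable (fun x => r x i) μ := fun i r hr =>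
    (EuclideanSpace.proj i : EuclideanSpace ℝ (Fin d) →L[ℝ] ℝ).continuous.comp_aestronglyMeasurable hr
  unfold matForm
  exact Finset.aestronglyMeasurable_fun_sum _ fun i _ => Finset.aestronglyMeasurable_fun_sum _ fun j _ =>
    ((hproj i hp).mul (hA i j).aestronglyMeasurable).mul (hproj j hq)

theorem exists_abs_le_of_continuous {f : ℝ → ℝ} (hf : Continuous f) (R : ℝ) :
    ∃ B, 0 ≤ B ∧ ∀ s, |s| ≤ R → |f s| ≤ B := by
  obtain ⟨B, hB⟩ := (isCompact_Icc (a := -R) (b := R)).exists_bound_of_continuousOn hf.continuousOn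
  exact ⟨max B 0, le_max_right _ _, fun s hs => (hB s (abs_le.1 hs)).trans (le_max_left _ _)⟩

open Filter Topology in
/-- The equation may be tested with `ζ ψ(u)` for smooth `ζ` and `ψ`. -/
theorem IsWeakSolution.integrableOn_and_integral_comp_eq_zero {d : ℕ}
    {A : EuclideanSpace ℝ (Fin d) → Matrix (Fin d) (Fin d) ℝ}
    {V : EuclideanSpace ℝ (Fin d) → ℝ} {H : ℝ} {g : ℝ → ℝ}
    {u : EuclideanSpace ℝ (Fin d) → ℝ} {Du : EuclideanSpace ℝ (Fin d) → EuclideanSpace ℝ (Fin d)}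
    (hw : IsWeakSolution A V H g u Du) (hu : IsTorusH1 u Du) (hcont : Continuous u)
    (hA : ∀ i j, Measurable fun x => A x i j) {Λ : ℝ} (hΛ : ∀ x i j, |A x i j| ≤ Λ) (hΛ0 : 0 ≤ Λ)
    (hV : Continuous V) {CV : ℝ} (hVH : ∀ x, |V x - H| ≤ CV) (hg : Continuous g)
    {ζ : EuclideanSpace ℝ (Fin d) → ℝ} (hζ : IsTorusTest ζ) {ψ : ℝ → ℝ} (hψ : ContDiff ℝ ∞ ψ) :
    IntegrableOn (fun x => matForm (A x)
        (ψ (u x) • gradient ζ x + (ζ x * deriv ψ (u x)) • Du x) (Du x)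
      + (1 / 2 * matForm (A x) (Du x) (Du x) + (V x - H) - g (-u x)) * (ζ x * ψ (u x)))
      (unitCube d) ∧
    ∫ x in unitCube d, (matForm (A x)
        (ψ (u x) • gradient ζ x + (ζ x * deriv ψ (u x)) • Du x) (Du x)
      + (1 / 2 * matForm (A x) (Du x) (Du x) + (V x - H) - g (-u x)) * (ζ x * ψ (u x))) = 0 := by
  obtain ⟨M, hM0, hM⟩ := hu.periodic.exists_norm_le hcont
  simp only [Real.norm_eq_abs] at hM
  obtain ⟨v, f, hv, hvb, hvl, hDv, hDvf, hfi, hfl, hfI⟩ := hu.exists_smooth_approximation hcont hM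
  have hψ' : Continuous (deriv ψ) := hψ.continuous_deriv (by simp)
  obtain ⟨N₁, hN₁0, hN₁⟩ := exists_abs_le_of_continuous hψ.continuous (3 * M)
  obtain ⟨N₂, hN₂0, hN₂⟩ := exists_abs_le_of_continuous hψ' (3 * M)
  obtain ⟨N₃, hN₃0, hN₃⟩ := hζ.2.exists_norm_le hζ.1.continuous
  obtain ⟨N₄, hN₄0, hN₄⟩ := hζ.2.gradient.exists_norm_le (continuous_gradient hζ.1)
  obtain ⟨c, hc0, hc⟩ := exists_abs_le_of_continuous hg M
  have hCV : 0 ≤ CV := (abs_nonneg _).trans (hVH 0)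
  set B : ℝ := (d : ℝ) ^ 2 * Λ with hB
  have hB0 : 0 ≤ B := by positivity
  have hmB : ∀ x p q, |matForm (A x) p q| ≤ B * ‖p‖ * ‖q‖ := fun x => abs_matForm_le (hΛ x) hΛ0
  set Q : EuclideanSpace ℝ (Fin d) → ℝ := fun x =>
    1 / 2 * matForm (A x) (Du x) (Du x) + (V x - H) - g (-u x) with hQ
  have hQb : ∀ x, |Q x| ≤ B * ‖Du x‖ ^ 2 + (CV + c) := by
    intro x
    have h1 := hmB x (Du x) (Du x)
    have h2 := hc (-u x) (by rw [abs_neg]; exact hM x)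
    have h3 := hVH x
    have h4 : 0 ≤ B * ‖Du x‖ * ‖Du x‖ := by positivity
    rw [abs_le] at *
    simp only [hQ]
    constructor <;> nlinarith [h1.1, h1.2, h2.1, h2.2, h3.1, h3.2]
  have hDum : AEStronglyMeasurable Du (volume.restrict (unitCube d)) :=
    hu.memLp_grad.aestronglyMeasurable
  have hQm : AEStronglyMeasurable Q (volume.restrict (unitCube d)) := by
    refine (((aestronglyMeasurable_matForm hA hDum hDum).const_mul _).add
      (hV.sub continuous_const).aestronglyMeasurable).sub
      (hg.comp hcont.neg).aestronglyMeasurable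
  have hD2 : IntegrableOn (fun x => ‖Du x‖ ^ 2) (unitCube d) :=
    hu.memLp_grad.integrable_norm_pow (by norm_num)
  set N : ℝ := max (max N₁ N₂) (max N₃ N₄) with hN
  have hN1 : N₁ ≤ N := (le_max_left _ _).trans (le_max_left _ _)
  have hN2 : N₂ ≤ N := (le_max_right _ _).trans (le_max_left _ _)
  have hN3 : N₃ ≤ N := (le_max_left _ _).trans (le_max_right _ _)
  have hN4 : N₄ ≤ N := (le_max_right _ _).trans (le_max_right _ _)
  have hN0 : 0 ≤ N := hN₁0.trans hN1
  -- One `B` comes from the bilinear term and one from the quadratic term in `Q`; `CV + c` bounds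
  -- the zero-order part, and `N ^ 2` the products of two bounded factors.
  set κ : ℝ := N ^ 2 * (2 * B + CV + c) with hκ
  have hone : ∀ {a : ℝ}, IntegrableOn (fun _ : EuclideanSpace ℝ (Fin d) => a) (unitCube d) :=
    fun {a} => integrable_const a
  have hlim := tendsto_integral_of_dominated_by_convergent
    (μ := volume.restrict (unitCube d))
    (F := fun n x => matForm (A x) (ψ (v n x) • gradient ζ x
      + (ζ x * deriv ψ (v n x)) • gradient (v n) x) (Du x) + Q x * (ζ x * ψ (v n x)))
    (G := fun n x => κ * (1 + ‖Du x‖ ^ 2 + f n x))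
    (F₀ := fun x => matForm (A x) (ψ (u x) • gradient ζ x
      + (ζ x * deriv ψ (u x)) • Du x) (Du x) + Q x * (ζ x * ψ (u x)))
    (G₀ := fun x => κ * (1 + ‖Du x‖ ^ 2 + ‖Du x‖ ^ 2))
    ?_ (fun n => ((hone.add hD2).add (hfi n)).const_mul κ) (((hone.add hD2).add hD2).const_mul κ)
    ?_ ?_ ?_ ?_
  · refine ⟨hlim.1, tendsto_nhds_unique hlim.2 ?_⟩
    refine tendsto_const_nhds.congr fun n => ?_
    rw [← hw (fun x => ζ x * ψ (v n x)) ⟨hζ.1.mul (hψ.comp (hv n).1),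
      hζ.2.comp₂ (hv n).2 fun a b => a * ψ b⟩]
    simp only [gradient_mul_comp hζ.1 (hv n).1 hψ, hQ]
  · intro n
    have hvc := (hv n).1.continuous
    refine (aestronglyMeasurable_matForm hA (Continuous.aestronglyMeasurable ?_) hDum).add
      (hQm.mul (hζ.1.continuous.mul (hψ.continuous.comp hvc)).aestronglyMeasurable)
    exact ((hψ.continuous.comp hvc).smul (continuous_gradient hζ.1)).add
      ((hζ.1.continuous.mul (hψ'.comp hvc)).smul (continuous_gradient (hv n).1))
  · intro n
    refine Eventually.of_forall fun x => ?_
    have a1 : |ψ (v n x)| ≤ N := (hN₁ _ (hvb n x)).trans hN1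
    have a2 : |deriv ψ (v n x)| ≤ N := (hN₂ _ (hvb n x)).trans hN2
    have a3 : |ζ x| ≤ N := (hN₃ x).trans hN3
    have a4 : ‖gradient ζ x‖ ≤ N := (hN₄ x).trans hN4
    have b1 : ‖ψ (v n x) • gradient ζ x + (ζ x * deriv ψ (v n x)) • gradient (v n) x‖
        ≤ N ^ 2 * (1 + ‖gradient (v n) x‖) := by
      refine (norm_add_le _ _).trans ?_
      rw [norm_smul, norm_smul, Real.norm_eq_abs, Real.norm_eq_abs, abs_mul]
      have e1 : |ψ (v n x)| * ‖gradient ζ x‖ ≤ N * N :=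
        mul_le_mul a1 a4 (norm_nonneg _) hN0
      have e2 : |ζ x| * |deriv ψ (v n x)| ≤ N * N := mul_le_mul a3 a2 (abs_nonneg _) hN0
      have e3 := mul_le_mul_of_nonneg_right e2 (norm_nonneg (gradient (v n) x))
      linarith
    have b2 := (hmB x (ψ (v n x) • gradient ζ x + (ζ x * deriv ψ (v n x)) • gradient (v n) x)
      (Du x)).trans (mul_le_mul_of_nonneg_right (mul_le_mul_of_nonneg_left b1 hB0)
        (norm_nonneg (Du x)))
    have b3 : (1 + ‖gradient (v n) x‖) * ‖Du x‖ ≤ 1 + ‖Du x‖ ^ 2 + f n x := by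
      have := hDvf n x
      nlinarith [sq_nonneg (‖Du x‖ - 1), sq_nonneg (‖Du x‖ - ‖gradient (v n) x‖)]
    have hf0 : 0 ≤ f n x := (sq_nonneg _).trans (hDvf n x)
    have b4 : |Q x * (ζ x * ψ (v n x))| ≤ (B * ‖Du x‖ ^ 2 + (CV + c)) * (N * N) := by
      rw [abs_mul, abs_mul]
      exact mul_le_mul (hQb x) (mul_le_mul a3 a1 (abs_nonneg _) hN0) (by positivity)
        (by positivity)
    have b5 : B * N ^ 2 * ((1 + ‖gradient (v n) x‖) * ‖Du x‖)
        ≤ B * N ^ 2 * (1 + ‖Du x‖ ^ 2 + f n x) := by gcongr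
    have b6 : B * N ^ 2 * ‖Du x‖ ^ 2 ≤ B * N ^ 2 * (1 + ‖Du x‖ ^ 2 + f n x) := by
      gcongr; linarith
    have b7 : (CV + c) * N ^ 2 * 1 ≤ (CV + c) * N ^ 2 * (1 + ‖Du x‖ ^ 2 + f n x) := by
      gcongr; nlinarith [sq_nonneg ‖Du x‖]
    refine (abs_add_le _ _).trans ((add_le_add b2 b4).trans ?_)
    rw [hκ]
    linarith
  · filter_upwards [ae_restrict_of_ae hDv] with x hx
    have l1 := (hψ.continuous.tendsto (u x)).comp (hvl x)
    have l2 := (hψ'.tendsto (u x)).comp (hvl x)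
    refine Tendsto.add ?_ ((l1.const_mul (ζ x)).const_mul (Q x))
    exact ((continuous_matForm_left (A x) (Du x)).tendsto _).comp
      ((l1.smul_const _).add ((l2.const_mul (ζ x)).smul hx))
  · filter_upwards [ae_restrict_of_ae hfl] with x hx
    exact (hx.const_add _).const_mul κ
  · simp only [integral_const_mul]
    refine Tendsto.const_mul κ (tendsto_const_nhds.congr fun n => ?_)
    have hi : IntegrableOn (fun x => 1 + ‖Du x‖ ^ 2) (unitCube d) := hone.add hD2
    rw [integral_add hi (hfi n), integral_add hi hD2, hfI n]

/-! ### Testing the equation: signs of the coupling and the Caccioppoli inequality -/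

/-- A continuous weak solution of the equation of the theorem, with bounded data. -/
structure IsBoundedWeakSolution {d : ℕ} (θ₀ θ₁ Λ CV : ℝ)
    (A : EuclideanSpace ℝ (Fin d) → Matrix (Fin d) (Fin d) ℝ)
    (V : EuclideanSpace ℝ (Fin d) → ℝ) (H : ℝ) (g : ℝ → ℝ)
    (u : EuclideanSpace ℝ (Fin d) → ℝ)
    (Du : EuclideanSpace ℝ (Fin d) → EuclideanSpace ℝ (Fin d)) : Prop where
  elliptic : IsEllipticMatrix θ₀ θ₁ Λ A
  nonneg : 0 ≤ Λ
  continuous_potential : Continuous V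
  potential_le : ∀ x, |V x - H| ≤ CV
  continuous_coupling : Continuous g
  sobolev : IsTorusH1 u Du
  continuous : Continuous u
  weak : IsWeakSolution A V H g u Du

theorem setIntegral_unitCube_pos {d : ℕ} {f : EuclideanSpace ℝ (Fin d) → ℝ}
    (hi : IntegrableOn f (unitCube d)) (hf : ∀ x, 0 < f x) : 0 < ∫ x in unitCube d, f x := by
  rw [setIntegral_pos_iff_support_of_nonneg_ae (Filter.Eventually.of_forall fun x => (hf x).le) hi]
  have : Function.support f = Set.univ := Set.eq_univ_of_forall fun x => (hf x).ne'
  rw [this, Set.univ_inter, volume_unitCube]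
  exact one_pos

namespace IsBoundedWeakSolution

variable {d : ℕ} {θ₀ θ₁ Λ CV : ℝ} {A : EuclideanSpace ℝ (Fin d) → Matrix (Fin d) (Fin d) ℝ}
  {V : EuclideanSpace ℝ (Fin d) → ℝ} {H : ℝ} {g : ℝ → ℝ} {u : EuclideanSpace ℝ (Fin d) → ℝ}
  {Du : EuclideanSpace ℝ (Fin d) → EuclideanSpace ℝ (Fin d)}

theorem comp_eq_zero (h : IsBoundedWeakSolution θ₀ θ₁ Λ CV A V H g u Du)
    {ζ : EuclideanSpace ℝ (Fin d) → ℝ} (hζ : IsTorusTest ζ) {ψ : ℝ → ℝ} (hψ : ContDiff ℝ ∞ ψ) :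
    IntegrableOn (fun x => ψ (u x) * matForm (A x) (gradient ζ x) (Du x)
      + ζ x * (deriv ψ (u x) + 1 / 2 * ψ (u x)) * matForm (A x) (Du x) (Du x)
      - (g (-u x) - (V x - H)) * (ζ x * ψ (u x))) (unitCube d) ∧
    ∫ x in unitCube d, (ψ (u x) * matForm (A x) (gradient ζ x) (Du x)
      + ζ x * (deriv ψ (u x) + 1 / 2 * ψ (u x)) * matForm (A x) (Du x) (Du x)
      - (g (-u x) - (V x - H)) * (ζ x * ψ (u x))) = 0 := by
  have key := h.weak.integrableOn_and_integral_comp_eq_zero h.sobolev h.continuous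
    h.elliptic.measurable h.elliptic.bounded h.nonneg h.continuous_potential h.potential_le
    h.continuous_coupling hζ hψ
  have e : ∀ x, matForm (A x) (ψ (u x) • gradient ζ x + (ζ x * deriv ψ (u x)) • Du x) (Du x)
      + (1 / 2 * matForm (A x) (Du x) (Du x) + (V x - H) - g (-u x)) * (ζ x * ψ (u x))
      = ψ (u x) * matForm (A x) (gradient ζ x) (Du x)
      + ζ x * (deriv ψ (u x) + 1 / 2 * ψ (u x)) * matForm (A x) (Du x) (Du x)
      - (g (-u x) - (V x - H)) * (ζ x * ψ (u x)) := by
    intro x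
    rw [matForm_add_left, matForm_smul_left, matForm_smul_left]
    ring
  simpa only [e] using key

theorem isTorusTest_const (a : ℝ) : IsTorusTest fun _ : EuclideanSpace ℝ (Fin d) => a :=
  ⟨contDiff_const, fun _ _ => rfl⟩

theorem matForm_gradient_const (M : Matrix (Fin d) (Fin d) ℝ) (a : ℝ)
    (x q : EuclideanSpace ℝ (Fin d)) :
    matForm M (gradient (fun _ : EuclideanSpace ℝ (Fin d) => a) x) q = 0 := by
  have : gradient (fun _ : EuclideanSpace ℝ (Fin d) => a) x = 0 := by
    simp [gradient]
  simp [this, matForm]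

/-- With `ψ(s) = exp(-s/2)` one has `ψ' + ½ ψ = 0`, so the gradient terms vanish and the coupling
has zero integral against a positive weight. -/
theorem exists_coupling_nonpos (h : IsBoundedWeakSolution θ₀ θ₁ Λ CV A V H g u Du) :
    ∃ x, g (-u x) - (V x - H) ≤ 0 := by
  by_contra! hpos
  have hψ : ContDiff ℝ ∞ fun s : ℝ => Real.exp (-(1 / 2) * s) := by fun_prop
  have hd : ∀ s, deriv (fun s : ℝ => Real.exp (-(1 / 2) * s)) s
      = -(1 / 2) * Real.exp (-(1 / 2) * s) := by
    intro s
    have : HasDerivAt (fun s : ℝ => Real.exp (-(1 / 2) * s)) _ s :=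
      ((hasDerivAt_id s).const_mul (-(1 / 2) : ℝ)).exp
    rw [this.deriv]
    simp [mul_comm]
  obtain ⟨hi, h0⟩ := h.comp_eq_zero (isTorusTest_const 1) hψ
  have e : ∀ x, Real.exp (-(1 / 2) * u x) * matForm (A x)
        (gradient (fun _ : EuclideanSpace ℝ (Fin d) => (1 : ℝ)) x) (Du x)
      + 1 * (deriv (fun s : ℝ => Real.exp (-(1 / 2) * s)) (u x)
        + 1 / 2 * Real.exp (-(1 / 2) * u x)) * matForm (A x) (Du x) (Du x)
      - (g (-u x) - (V x - H)) * (1 * Real.exp (-(1 / 2) * u x))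
      = -((g (-u x) - (V x - H)) * Real.exp (-(1 / 2) * u x)) := by
    intro x
    rw [hd, matForm_gradient_const]
    ring
  simp only [e] at hi h0
  have hi' : IntegrableOn (fun x => (g (-u x) - (V x - H)) * Real.exp (-(1 / 2) * u x))
      (unitCube d) := by simpa using hi.neg
  have := setIntegral_unitCube_pos hi' fun x => mul_pos (hpos x) (Real.exp_pos _)
  rw [integral_neg] at h0
  linarith

/-- Tested with `1`, the equation equates the integral of the coupling with that of a nonnegative
quadratic form. -/
theorem exists_coupling_nonneg (h : IsBoundedWeakSolution θ₀ θ₁ Λ CV A V H g u Du)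
    (hθ₀ : 0 < θ₀) : ∃ x, 0 ≤ g (-u x) - (V x - H) := by
  by_contra! hneg
  obtain ⟨hi, h0⟩ := h.comp_eq_zero (isTorusTest_const 1) (contDiff_const (c := (1 : ℝ)))
  refine (setIntegral_unitCube_pos hi fun x => ?_).ne' h0
  have h1 := h.elliptic.lower x (Du x)
  have h2 : 0 ≤ θ₀ * ‖Du x‖ ^ 2 := by positivity
  rw [matForm_gradient_const, deriv_const]
  nlinarith [hneg x]

/-- Test with `η² (u - c)`. On the support of `η`, `0 ≤ u - c ≤ δ`: the lower bound gives the
quadratic term a favourable sign, and the upper bound puts `δ` in front of the coupling and cross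
terms. Half of the ellipticity is spent on absorbing the cross term. -/
theorem caccioppoli (h : IsBoundedWeakSolution θ₀ θ₁ Λ CV A V H g u Du) (hθ₀ : 0 < θ₀)
    {C₁ : ℝ} (hC₁ : ∀ x, |g (-u x) - (V x - H)| ≤ C₁) {η : EuclideanSpace ℝ (Fin d) → ℝ}
    (hη : IsTorusTest η) {c δ : ℝ} (hδ : 0 ≤ δ) (hc : ∀ x, η x ≠ 0 → c ≤ u x ∧ u x ≤ c + δ) :
    θ₀ / 2 * ∫ x in unitCube d, η x ^ 2 * ‖Du x‖ ^ 2
      ≤ C₁ * δ * (∫ x in unitCube d, η x ^ 2)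
        + 2 * ((d : ℝ) ^ 2 * Λ) ^ 2 * δ ^ 2 / θ₀ * ∫ x in unitCube d, ‖gradient η x‖ ^ 2 := by
  have hηη : IsTorusTest fun x => η x * η x := ⟨hη.1.mul hη.1, hη.2.comp₂ hη.2 fun a b => a * b⟩
  have hgrad : ∀ x, gradient (fun x => η x * η x) x = (2 * η x) • gradient η x := by
    intro x
    have := gradient_mul_comp hη.1 hη.1 (contDiff_id (𝕜 := ℝ) (E := ℝ)) x
    simp only [id_eq, deriv_id, mul_one] at this
    rw [this, two_mul, add_smul]
  obtain ⟨hi, h0⟩ := h.comp_eq_zero hηη (ψ := fun s => s - c) (contDiff_id.sub contDiff_const)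
  have hd : ∀ s : ℝ, deriv (fun s => s - c) s = 1 := fun s => by simp
  simp only [hgrad, hd, matForm_smul_left] at hi h0
  set B : ℝ := (d : ℝ) ^ 2 * Λ with hB
  have hB0 : 0 ≤ B := by have := h.nonneg; positivity
  obtain ⟨N, hN0, hN⟩ := hη.2.exists_norm_le hη.1.continuous
  have hD2 : IntegrableOn (fun x => ‖Du x‖ ^ 2) (unitCube d) :=
    h.sobolev.memLp_grad.integrable_norm_pow (by norm_num)
  have i1 : IntegrableOn (fun x => η x ^ 2 * ‖Du x‖ ^ 2) (unitCube d) :=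
    hD2.bdd_mul (c := N ^ 2) (hη.1.continuous.pow 2).aestronglyMeasurable
      (Filter.Eventually.of_forall fun x => by
        rw [norm_pow]; exact pow_le_pow_left₀ (norm_nonneg _) (hN x) 2)
  have i2 : IntegrableOn (fun x => η x ^ 2) (unitCube d) :=
    (hη.1.continuous.pow 2).integrableOn_unitCube
  have i3 : IntegrableOn (fun x => ‖gradient η x‖ ^ 2) (unitCube d) :=
    ((continuous_gradient hη.1).norm.pow 2).integrableOn_unitCube
  -- The left integrand is pointwise below the tested one, whose integral is zero.
  have hle : ∫ x in unitCube d, (θ₀ / 2 * (η x ^ 2 * ‖Du x‖ ^ 2) - C₁ * δ * η x ^ 2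
      - 2 * B ^ 2 * δ ^ 2 / θ₀ * ‖gradient η x‖ ^ 2) ≤ 0 := by
    rw [← h0]
    refine integral_mono (((i1.const_mul _).sub (i2.const_mul _)).sub (i3.const_mul _)) hi
      fun x => ?_
    simp only
    have hC₁0 : 0 ≤ C₁ := (abs_nonneg _).trans (hC₁ x)
    have hn : 0 ≤ 2 * B ^ 2 * δ ^ 2 / θ₀ * ‖gradient η x‖ ^ 2 := by positivity
    by_cases hx : η x = 0
    · rw [hx]
      norm_num
      exact hn
    · obtain ⟨hu0, hu1⟩ := hc x hx
      have a1 := h.elliptic.lower x (Du x)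
      have a2 := abs_matForm_le (h.elliptic.bounded x) h.nonneg (gradient η x) (Du x)
      rw [← hB] at a2
      have a3 := hC₁ x
      set w := u x - c with hw
      have hw0 : 0 ≤ w := by linarith
      have hw1 : w ≤ δ := by linarith
      set m := matForm (A x) (Du x) (Du x)
      set b := matForm (A x) (gradient η x) (Du x)
      set F := g (-u x) - (V x - H)
      have hm0 : 0 ≤ m := le_trans (by positivity) a1
      have b1 : F * (η x * η x * w) ≤ C₁ * δ * η x ^ 2 := by
        have e1 : F * w ≤ C₁ * δ :=
          mul_le_mul ((le_abs_self F).trans a3) hw1 hw0 hC₁0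
        nlinarith [mul_le_mul_of_nonneg_right e1 (sq_nonneg (η x))]
      have b2 : -(2 * |η x| * δ * B * ‖gradient η x‖ * ‖Du x‖) ≤ w * (2 * η x * b) := by
        have e1 : |w * (2 * η x * b)| ≤ δ * (2 * |η x| * (B * ‖gradient η x‖ * ‖Du x‖)) := by
          rw [abs_mul, abs_mul, abs_mul, abs_two, abs_of_nonneg hw0]
          gcongr
        have := (abs_le.1 e1).1
        linarith
      have b3 : 2 * |η x| * δ * B * ‖gradient η x‖ * ‖Du x‖
          ≤ θ₀ / 2 * (η x ^ 2 * ‖Du x‖ ^ 2) + 2 * B ^ 2 * δ ^ 2 / θ₀ * ‖gradient η x‖ ^ 2 := by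
        -- Young's inequality with weights chosen to make the difference a perfect square.
        have e1 : θ₀ / 2 * (η x ^ 2 * ‖Du x‖ ^ 2) + 2 * B ^ 2 * δ ^ 2 / θ₀ * ‖gradient η x‖ ^ 2
            - 2 * |η x| * δ * B * ‖gradient η x‖ * ‖Du x‖
            = (θ₀ * (|η x| * ‖Du x‖) - 2 * (B * δ * ‖gradient η x‖)) ^ 2 / (2 * θ₀) := by
          rw [← sq_abs (η x)]
          field_simp
          ring
        have e2 : 0 ≤ (θ₀ * (|η x| * ‖Du x‖) - 2 * (B * δ * ‖gradient η x‖)) ^ 2 / (2 * θ₀) := by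
          positivity
        linarith
      have b4 : θ₀ * (η x ^ 2 * ‖Du x‖ ^ 2) ≤ η x * η x * (1 + 1 / 2 * w) * m := by
        have e1 : 0 ≤ η x ^ 2 * (1 / 2 * w * m) := by positivity
        nlinarith [mul_le_mul_of_nonneg_left a1 (sq_nonneg (η x))]
      linarith
  have i12 : IntegrableOn (fun x => θ₀ / 2 * (η x ^ 2 * ‖Du x‖ ^ 2) - C₁ * δ * η x ^ 2)
      (unitCube d) := (i1.const_mul _).sub (i2.const_mul _)
  rw [integral_sub i12 (i3.const_mul _),
    integral_sub (i1.const_mul _) (i2.const_mul _), integral_const_mul, integral_const_mul,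
    integral_const_mul] at hle
  linarith

end IsBoundedWeakSolution

/-! ### A smooth periodic squared distance and cutoff functions -/

/-- A smooth periodic function comparable to the squared distance to `x` on the torus. -/
noncomputable def sineSqDist {d : ℕ} (x y : EuclideanSpace ℝ (Fin d)) : ℝ :=
  ∑ i, Real.sin (Real.pi * (y i - x i)) ^ 2

theorem sineSqDist_nonneg {d : ℕ} (x y : EuclideanSpace ℝ (Fin d)) : 0 ≤ sineSqDist x y :=
  Finset.sum_nonneg fun _ _ => sq_nonneg _

theorem torusPeriodic_sineSqDist {d : ℕ} (x : EuclideanSpace ℝ (Fin d)) :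
    TorusPeriodic (sineSqDist x) := by
  intro k y
  refine Finset.sum_congr rfl fun i _ => ?_
  have h : Real.pi * ((y + WithLp.toLp 2 (fun i => (k i : ℝ))) i - x i)
      = Real.pi * (y i - x i) + k i * Real.pi := by
    rw [PiLp.add_apply]; ring
  rw [h, Real.sin_add_int_mul_pi, mul_pow, ← zpow_natCast, ← zpow_mul, mul_comm (k i), zpow_mul]
  simp

theorem contDiff_sineSqDist {d : ℕ} (x : EuclideanSpace ℝ (Fin d)) :
    ContDiff ℝ ∞ (sineSqDist x) := by
  unfold sineSqDist
  fun_prop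

theorem gradient_sineSqDist_apply {d : ℕ} (x y : EuclideanSpace ℝ (Fin d)) (i : Fin d) :
    gradient (sineSqDist x) y i = 2 * Real.pi * Real.sin (Real.pi * (y i - x i))
      * Real.cos (Real.pi * (y i - x i)) := by
  have h : HasFDerivAt (sineSqDist x) (∑ j, (2 * Real.pi * Real.sin (Real.pi * (y j - x j))
      * Real.cos (Real.pi * (y j - x j))) •
        (EuclideanSpace.proj j : EuclideanSpace ℝ (Fin d) →L[ℝ] ℝ)) y := by
    refine HasFDerivAt.fun_sum fun j _ => ?_
    have h1 : HasFDerivAt (fun z : EuclideanSpace ℝ (Fin d) => z j)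
        (EuclideanSpace.proj j : EuclideanSpace ℝ (Fin d) →L[ℝ] ℝ) y :=
      (EuclideanSpace.proj j : EuclideanSpace ℝ (Fin d) →L[ℝ] ℝ).hasFDerivAt
    have h2 : HasDerivAt (fun s : ℝ => Real.sin (Real.pi * (s - x j)) ^ 2)
        (2 * Real.pi * Real.sin (Real.pi * (y j - x j)) * Real.cos (Real.pi * (y j - x j)))
        (y j) := by
      refine ((((hasDerivAt_id' (y j)).sub_const (x j)).const_mul Real.pi).sin.pow 2).congr_deriv ?_
      simp only [Nat.cast_ofNat, mul_one]
      ring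
    exact h2.comp_hasFDerivAt y h1
  rw [gradient_apply, h.fderiv, sum_apply, Finset.sum_eq_single i]
  · simp
  · intro j _ hj
    simp [hj]
  · simp

theorem norm_gradient_sineSqDist_sq_le {d : ℕ} (x y : EuclideanSpace ℝ (Fin d)) :
    ‖gradient (sineSqDist x) y‖ ^ 2 ≤ 4 * Real.pi ^ 2 * sineSqDist x y := by
  rw [EuclideanSpace.norm_sq_eq, sineSqDist, Finset.mul_sum]
  refine Finset.sum_le_sum fun i _ => ?_
  rw [gradient_sineSqDist_apply, Real.norm_eq_abs, sq_abs]
  have h1 := Real.sin_sq_add_cos_sq (Real.pi * (y i - x i))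
  set s := Real.sin (Real.pi * (y i - x i))
  set c := Real.cos (Real.pi * (y i - x i))
  have h2 : c ^ 2 ≤ 1 := by nlinarith [sq_nonneg s]
  have h3 : 0 ≤ 4 * Real.pi ^ 2 * s ^ 2 := by positivity
  calc (2 * Real.pi * s * c) ^ 2 = 4 * Real.pi ^ 2 * s ^ 2 * c ^ 2 := by ring
    _ ≤ 4 * Real.pi ^ 2 * s ^ 2 * 1 := mul_le_mul_of_nonneg_left h2 h3
    _ = _ := by ring

theorem sineSqDist_le_dist_sq {d : ℕ} (x y : EuclideanSpace ℝ (Fin d)) :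
    sineSqDist x y ≤ Real.pi ^ 2 * dist y x ^ 2 := by
  rw [EuclideanSpace.dist_sq_eq, Finset.mul_sum]
  refine Finset.sum_le_sum fun i _ => ?_
  rw [Real.dist_eq, sq_abs, ← mul_pow]
  exact Real.sin_sq_le_sq

/-- Jordan's inequality `|sin t| ≥ 2 |t| / π` on `|t| ≤ π / 2`, in each coordinate. -/
theorem dist_sq_le_sineSqDist {d : ℕ} {x y : EuclideanSpace ℝ (Fin d)}
    (h : ∀ i, |y i - x i| ≤ 1 / 2) : 4 * dist y x ^ 2 ≤ sineSqDist x y := by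
  rw [EuclideanSpace.dist_sq_eq, Finset.mul_sum]
  refine Finset.sum_le_sum fun i _ => ?_
  rw [Real.dist_eq]
  have hπ := Real.pi_pos
  have h1 : |Real.pi * (y i - x i)| = Real.pi * |y i - x i| := by
    rw [abs_mul, abs_of_pos hπ]
  have h2 := Real.mul_abs_le_abs_sin (x := Real.pi * (y i - x i)) (by
    rw [h1]; nlinarith [h i])
  rw [h1, ← mul_assoc, div_mul_cancel₀ _ hπ.ne'] at h2
  rw [← sq_abs (Real.sin _)]
  nlinarith [abs_nonneg (y i - x i)]

theorem exists_integerVector_dist_sq_le {d : ℕ} (x y : EuclideanSpace ℝ (Fin d)) :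
    ∃ k : Fin d → ℤ, 4 * dist (y + WithLp.toLp 2 (fun i => (k i : ℝ))) x ^ 2 ≤ sineSqDist x y := by
  refine ⟨fun i => -round (y i - x i), ?_⟩
  rw [← torusPeriodic_sineSqDist x (fun i => -round (y i - x i)) y]
  refine dist_sq_le_sineSqDist fun i => ?_
  have := abs_sub_round (y i - x i)
  rw [PiLp.add_apply]
  push_cast
  rwa [add_sub_right_comm, ← sub_eq_add_neg]

theorem sineSqDist_le_of_mem_torusBall {d : ℕ} {x y : EuclideanSpace ℝ (Fin d)} {r : ℝ}
    (h : y ∈ torusBall x r) : sineSqDist x y ≤ Real.pi ^ 2 * r ^ 2 := by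
  obtain ⟨k, hk⟩ := h
  rw [← torusPeriodic_sineSqDist x k y]
  refine (sineSqDist_le_dist_sq _ _).trans ?_
  gcongr

theorem dist_le_of_sineSqDist_le {ρ r s : ℝ} (hr : 0 ≤ r) (h : s ≤ 2 * (Real.pi ^ 2 * r ^ 2))
    (hs : 4 * ρ ^ 2 ≤ s) : ρ ≤ 4 * r := by
  have h1 : Real.pi ^ 2 ≤ 16 := by nlinarith [Real.pi_le_four, Real.pi_pos]
  refine le_of_sq_le_sq (b := 4 * r) ?_ (by positivity)
  nlinarith [mul_le_mul_of_nonneg_right h1 (sq_nonneg r)]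

/-- By periodicity the cube may be recentred at `x`, where every coordinate difference is at most
`1/2`. There the sublevel set lies in a single Euclidean ball of radius `4 r`. -/
theorem volume_sineSqDist_le {d : ℕ} (x : EuclideanSpace ℝ (Fin d)) {r : ℝ} (hr : 0 ≤ r) :
    volume (unitCube d ∩ {y | sineSqDist x y ≤ 2 * (Real.pi ^ 2 * r ^ 2)})
      ≤ ENNReal.ofReal ((4 * r) ^ d) * volume (Metric.ball (0 : EuclideanSpace ℝ (Fin d)) 1) := by
  set P : Set (EuclideanSpace ℝ (Fin d)) := {y | sineSqDist x y ≤ 2 * (Real.pi ^ 2 * r ^ 2)} with hP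
  set h : EuclideanSpace ℝ (Fin d) := WithLp.toLp 2 fun _ => 1 / 2 with hh
  have hPm : MeasurableSet P :=
    (isClosed_le (contDiff_sineSqDist x).continuous continuous_const).measurableSet
  have hper : TorusPeriodic (P.indicator (1 : EuclideanSpace ℝ (Fin d) → ℝ≥0∞)) := by
    intro k y
    have : (y + WithLp.toLp 2 (fun i => (k i : ℝ))) ∈ P ↔ y ∈ P := by
      simp only [hP, Set.mem_ofPred_eq, torusPeriodic_sineSqDist x k y]
    by_cases hy : y ∈ P
    · rw [Set.indicator_of_mem hy, Set.indicator_of_mem (this.2 hy)]; rfl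
    · rw [Set.indicator_of_notMem hy, Set.indicator_of_notMem (mt this.1 hy)]
  have h1 := hper.setLIntegral_add (x - h)
  rw [lintegral_indicator_one hPm, Measure.restrict_apply hPm, Set.inter_comm] at h1
  have h2 : (fun z => P.indicator (1 : EuclideanSpace ℝ (Fin d) → ℝ≥0∞) (z + (x - h)))
      = ((fun z => z + (x - h)) ⁻¹' P).indicator 1 := rfl
  have hm : MeasurableSet ((fun z => z + (x - h)) ⁻¹' P) := hPm.preimage (by fun_prop)
  rw [← h1, h2, lintegral_indicator_one hm, Measure.restrict_apply hm]
  have h3 := Measure.addHaar_closedBall (volume : Measure (EuclideanSpace ℝ (Fin d))) h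
    (show 0 ≤ 4 * r by positivity)
  rw [finrank_euclideanSpace_fin] at h3
  rw [← h3]
  refine measure_mono fun z hz => ?_
  have hz1 : sineSqDist x (z + (x - h)) ≤ 2 * (Real.pi ^ 2 * r ^ 2) := hz.1
  rw [Metric.mem_closedBall]
  have h4 : dist (z + (x - h)) x = dist z h := by
    rw [dist_eq_norm, dist_eq_norm]
    congr 1
    abel
  rw [← h4]
  refine dist_le_of_sineSqDist_le hr hz1 (dist_sq_le_sineSqDist fun i => ?_)
  have h5 : (z + (x - h)) i - x i = z i - 1 / 2 := by
    simp only [PiLp.add_apply, PiLp.sub_apply, hh]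
    ring
  rw [h5, abs_le]
  have := hz.2 i
  constructor <;> linarith [this.1, this.2]

theorem exists_deriv_smoothTransition_bound :
    ∃ L, 0 ≤ L ∧ ∀ s, |s| ≤ 2 → |deriv (fun s => Real.smoothTransition (2 - s)) s| ≤ L :=
  exists_abs_le_of_continuous ((Real.smoothTransition.contDiff (n := ⊤).comp
    (contDiff_const.sub contDiff_id)).continuous_deriv (by simp)) 2

/-- Cutoff functions on the torus. -/
theorem exists_torus_cutoff (d : ℕ) : ∃ L, 0 ≤ L ∧ ∀ (x : EuclideanSpace ℝ (Fin d)) (r : ℝ),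
    0 < r → ∃ η : EuclideanSpace ℝ (Fin d) → ℝ, IsTorusTest η ∧ (∀ y ∈ torusBall x r, η y = 1) ∧
      (∀ y, η y ^ 2 ≤ 1) ∧ (∀ y, ‖gradient η y‖ ^ 2 ≤ L / r ^ 2) ∧
      (∀ y, 2 * (Real.pi ^ 2 * r ^ 2) < sineSqDist x y → η y = 0 ∧ gradient η y = 0) := by
  obtain ⟨L, hL0, hL⟩ := exists_deriv_smoothTransition_bound
  refine ⟨8 * L ^ 2, by positivity, fun x r hr => ?_⟩
  have hπ := Real.pi_pos
  -- With this scaling `a * sineSqDist x y ≤ 1` on the torus ball of radius `r`, and the transition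
  -- takes place while this quantity runs from `1` to `2`.
  set a : ℝ := (Real.pi ^ 2 * r ^ 2)⁻¹ with ha
  have ha0 : 0 < a := by positivity
  have hac : a * (Real.pi ^ 2 * r ^ 2) = 1 := inv_mul_cancel₀ (by positivity)
  set χ : ℝ → ℝ := fun s => Real.smoothTransition (2 - s) with hχ
  have hχs : ContDiff ℝ ∞ χ :=
    Real.smoothTransition.contDiff.comp (contDiff_const.sub contDiff_id)
  have hηs : ContDiff ℝ ∞ fun y => χ (a * sineSqDist x y) :=
    hχs.comp (contDiff_const.mul (contDiff_sineSqDist x))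
  have hgrad : ∀ y, gradient (fun y => χ (a * sineSqDist x y)) y
      = (deriv χ (a * sineSqDist x y) * a) • gradient (sineSqDist x) y := by
    intro y
    have h1 := ((contDiff_sineSqDist x).differentiable (by simp) y).hasFDerivAt.const_mul a
    have h2 := (hχs.differentiable (by simp) (a * sineSqDist x y)).hasDerivAt
    have h2' := h2.comp_hasFDerivAt y h1
    have h3 : fderiv ℝ (fun y => χ (a * sineSqDist x y)) y = _ := h2'.fderiv
    ext i
    rw [gradient_apply, h3, PiLp.smul_apply, gradient_apply]
    simp [mul_assoc]
  have hzero : ∀ y, 2 * (Real.pi ^ 2 * r ^ 2) < sineSqDist x y → 2 < a * sineSqDist x y := by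
    intro y hy
    have := mul_lt_mul_of_pos_left hy ha0
    nlinarith
  have hgrad0 : ∀ y, 2 * (Real.pi ^ 2 * r ^ 2) < sineSqDist x y →
      gradient (fun y => χ (a * sineSqDist x y)) y = 0 := by
    intro y hy
    have h1 : χ =ᶠ[nhds (a * sineSqDist x y)] fun _ => (0 : ℝ) := by
      filter_upwards [lt_mem_nhds (hzero y hy)] with s hs
      exact Real.smoothTransition.zero_of_nonpos (by linarith)
    rw [hgrad, h1.deriv_eq, deriv_const, zero_mul, zero_smul]
  refine ⟨fun y => χ (a * sineSqDist x y), ⟨hηs, (torusPeriodic_sineSqDist x).comp fun s => χ (a * s)⟩,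
    fun y hy => ?_, fun y => ?_, fun y => ?_, fun y hy => ⟨?_, hgrad0 y hy⟩⟩
  · refine Real.smoothTransition.one_of_one_le ?_
    have := mul_le_mul_of_nonneg_left (sineSqDist_le_of_mem_torusBall hy) ha0.le
    linarith
  · exact pow_le_one₀ (Real.smoothTransition.nonneg _) (Real.smoothTransition.le_one _)
  · rcases lt_or_ge (2 * (Real.pi ^ 2 * r ^ 2)) (sineSqDist x y) with hy | hy
    · rw [hgrad0 y hy]
      simp only [norm_zero, ne_eq, OfNat.ofNat_ne_zero, not_false_eq_true, zero_pow]
      positivity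
    · have h1 : a * sineSqDist x y ≤ 2 := by
        have := mul_le_mul_of_nonneg_left hy ha0.le
        linarith
      have h2 : 0 ≤ a * sineSqDist x y := mul_nonneg ha0.le (sineSqDist_nonneg x y)
      have h3 := hL (a * sineSqDist x y) (by rwa [abs_of_nonneg h2])
      rw [hgrad, norm_smul, Real.norm_eq_abs, mul_pow, sq_abs, mul_pow]
      have h4 : deriv χ (a * sineSqDist x y) ^ 2 ≤ L ^ 2 := by
        rw [← sq_abs]
        exact pow_le_pow_left₀ (abs_nonneg _) h3 2
      calc deriv χ (a * sineSqDist x y) ^ 2 * a ^ 2 * ‖gradient (sineSqDist x) y‖ ^ 2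
          ≤ L ^ 2 * a ^ 2 * (4 * Real.pi ^ 2 * sineSqDist x y) :=
            mul_le_mul (mul_le_mul_of_nonneg_right h4 (sq_nonneg a))
              (norm_gradient_sineSqDist_sq_le x y) (sq_nonneg _) (by positivity)
        _ = 4 * L ^ 2 * Real.pi ^ 2 * a * (a * sineSqDist x y) := by ring
        _ ≤ 4 * L ^ 2 * Real.pi ^ 2 * a * 2 := by gcongr
        _ = 8 * L ^ 2 / r ^ 2 := by
            rw [ha]
            field_simp
            ring
  · exact Real.smoothTransition.zero_of_nonpos (by linarith [hzero y hy])

/-! ### Oscillation, a priori bounds and energy on balls -/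

theorem IsTorusHolder.continuous {d : ℕ} {K α : ℝ} {u : EuclideanSpace ℝ (Fin d) → ℝ}
    (hu : IsTorusHolder K α u) (hα : 0 < α) : Continuous u := by
  refine continuous_iff_continuousAt.2 fun x => ?_
  rw [ContinuousAt, tendsto_iff_dist_tendsto_zero]
  have h : Filter.Tendsto (fun y => K * dist y x ^ α) (nhds x) (nhds (K * dist x x ^ α)) :=
    ((continuous_id.dist continuous_const).rpow_const fun _ => Or.inr hα.le).const_mul K
      |>.continuousAt
  rw [dist_self, Real.zero_rpow hα.ne', mul_zero] at h
  exact squeeze_zero (fun y => dist_nonneg) (fun y => hu.2 y x) h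

theorem IsTorusHolder.abs_sub_le_of_dist_le {d : ℕ} {K α : ℝ} {u : EuclideanSpace ℝ (Fin d) → ℝ}
    (hu : IsTorusHolder K α u) (hK : 0 ≤ K) (hα : 0 < α) {x y : EuclideanSpace ℝ (Fin d)} {ρ : ℝ}
    (h : dist x y ≤ ρ) : |u x - u y| ≤ K * ρ ^ α :=
  (hu.2 x y).trans (mul_le_mul_of_nonneg_left (Real.rpow_le_rpow dist_nonneg h hα.le) hK)

/-- Periodicity moves both points into the unit cube, which lies within distance `√d` of the origin.
-/
theorem IsTorusHolder.abs_sub_le {d : ℕ} {K α : ℝ} {u : EuclideanSpace ℝ (Fin d) → ℝ}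
    (hu : IsTorusHolder K α u) (hK : 0 ≤ K) (hα : 0 < α) (x y : EuclideanSpace ℝ (Fin d)) :
    |u x - u y| ≤ K * (2 * √d) ^ α := by
  obtain ⟨l, hl, -⟩ := existsUnique_vadd_mem_unitCube x
  obtain ⟨m, hm, -⟩ := existsUnique_vadd_mem_unitCube y
  rw [← hu.1.apply_vadd l x, ← hu.1.apply_vadd m y]
  refine hu.abs_sub_le_of_dist_le hK hα ?_
  have h1 := unitCube_subset_closedBall d hl
  have h2 := unitCube_subset_closedBall d hm
  rw [Metric.mem_closedBall] at h1 h2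
  linarith [dist_triangle_right (l +ᵥ x) (m +ᵥ y) (0 : EuclideanSpace ℝ (Fin d))]

theorem IsTorusHolder.abs_sub_le_of_sineSqDist_le {d : ℕ} {K α : ℝ}
    {u : EuclideanSpace ℝ (Fin d) → ℝ} (hu : IsTorusHolder K α u) (hK : 0 ≤ K) (hα : 0 < α)
    {x y : EuclideanSpace ℝ (Fin d)} {r : ℝ} (hr : 0 ≤ r)
    (h : sineSqDist x y ≤ 2 * (Real.pi ^ 2 * r ^ 2)) : |u y - u x| ≤ K * (4 * r) ^ α := by
  obtain ⟨k, hk⟩ := exists_integerVector_dist_sq_le x y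
  rw [← hu.1 k y]
  exact hu.abs_sub_le_of_dist_le hK hα (dist_le_of_sineSqDist_le hr h hk)

namespace IsBoundedWeakSolution

variable {d : ℕ} {θ₀ θ₁ Λ CV : ℝ} {A : EuclideanSpace ℝ (Fin d) → Matrix (Fin d) (Fin d) ℝ}
  {V : EuclideanSpace ℝ (Fin d) → ℝ} {H : ℝ} {g : ℝ → ℝ} {u : EuclideanSpace ℝ (Fin d) → ℝ}
  {Du : EuclideanSpace ℝ (Fin d) → EuclideanSpace ℝ (Fin d)}

/-- The sign condition on `g` bounds `u` below at a point where the coupling is nonpositive and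
above at one where it is nonnegative; the global oscillation bound does the rest. -/
theorem abs_le (h : IsBoundedWeakSolution θ₀ θ₁ Λ CV A V H g u Du) (hθ₀ : 0 < θ₀) {Cg K α : ℝ}
    (hCg : 0 < Cg) (hg : IsCoupling Cg g) (hu : IsTorusHolder K α u) (hK : 0 ≤ K) (hα : 0 < α)
    (y : EuclideanSpace ℝ (Fin d)) :
    |u y| ≤ (1 / Cg + CV) / Cg + K * (2 * √d) ^ α := by
  have hCV : 0 ≤ CV := (abs_nonneg _).trans (h.potential_le 0)
  have hM : 0 ≤ (1 / Cg + CV) / Cg := by positivity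
  obtain ⟨x, hx⟩ := h.exists_coupling_nonpos
  obtain ⟨z, hz⟩ := h.exists_coupling_nonneg hθ₀
  have hlow : -((1 / Cg + CV) / Cg) ≤ u x := by
    by_contra! hlt
    have h1 := hg.growth (-u x)
    have h2 : 0 < -u x := by linarith
    rw [Real.sign_of_pos h2, abs_of_pos h2, mul_one] at h1
    have h3 := (_root_.abs_le.1 (h.potential_le x)).2
    have h4 : -u x ≤ (1 / Cg + CV) / Cg := by
      rw [le_div_iff₀ hCg]
      linarith
    linarith
  have hup : u z ≤ (1 / Cg + CV) / Cg := by
    by_contra! hlt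
    have h1 := hg.growth (-u z)
    have h2 : -u z < 0 := by linarith
    rw [Real.sign_of_neg h2, abs_of_neg h2] at h1
    have h3 := (_root_.abs_le.1 (h.potential_le z)).1
    have h4 : u z ≤ (1 / Cg + CV) / Cg := by
      rw [le_div_iff₀ hCg]
      linarith
    linarith
  have h5 := _root_.abs_le.1 (hu.abs_sub_le hK hα y x)
  have h6 := _root_.abs_le.1 (hu.abs_sub_le hK hα y z)
  rw [_root_.abs_le]
  constructor <;> linarith [h5.1, h6.2]

theorem setIntegral_norm_sq_le (h : IsBoundedWeakSolution θ₀ θ₁ Λ CV A V H g u Du) (hθ₀ : 0 < θ₀)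
    {M C₁ : ℝ} (hM : ∀ x, |u x| ≤ M) (hC₁ : ∀ x, |g (-u x) - (V x - H)| ≤ C₁) :
    ∫ x in unitCube d, ‖Du x‖ ^ 2 ≤ 2 / θ₀ * (C₁ * (2 * M)) := by
  have hM0 : 0 ≤ M := (abs_nonneg _).trans (hM 0)
  have hc := h.caccioppoli hθ₀ hC₁ (isTorusTest_const 1) (c := -M) (δ := 2 * M) (by positivity)
    fun x _ => by
      have := _root_.abs_le.1 (hM x)
      constructor <;> linarith [this.1, this.2]
  have hg : ∀ x, gradient (fun _ : EuclideanSpace ℝ (Fin d) => (1 : ℝ)) x = 0 := fun x => by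
    simp [gradient]
  have hv : (volume (unitCube d)).toReal = 1 := by rw [volume_unitCube, ENNReal.toReal_one]
  simp only [hg, one_pow, one_mul, norm_zero, ne_eq, OfNat.ofNat_ne_zero, not_false_eq_true,
    zero_pow, integral_zero, mul_zero, add_zero, integral_const, measureReal_def,
    Measure.restrict_apply_univ, hv, smul_eq_mul, mul_one] at hc
  rw [div_mul_eq_mul_div, le_div_iff₀ hθ₀]
  linarith

theorem setIntegral_norm_sq_torusBall_le {L : ℝ} (h : IsBoundedWeakSolution θ₀ θ₁ Λ CV A V H g u Du)
    (hθ₀ : 0 < θ₀) {C₁ K α : ℝ} (hC₁ : ∀ x, |g (-u x) - (V x - H)| ≤ C₁)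
    (hu : IsTorusHolder K α u) (hK : 0 ≤ K) (hα : 0 < α) (hL : 0 ≤ L)
    {x : EuclideanSpace ℝ (Fin d)} {r : ℝ} (hr : 0 < r) {η : EuclideanSpace ℝ (Fin d) → ℝ}
    (hη : IsTorusTest η) (h1 : ∀ y ∈ torusBall x r, η y = 1) (h2 : ∀ y, η y ^ 2 ≤ 1)
    (h3 : ∀ y, ‖gradient η y‖ ^ 2 ≤ L / r ^ 2)
    (h4 : ∀ y, 2 * (Real.pi ^ 2 * r ^ 2) < sineSqDist x y → η y = 0 ∧ gradient η y = 0) :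
    ∫ y in unitCube d ∩ torusBall x r, ‖Du y‖ ^ 2
      ≤ 2 / θ₀ * ((C₁ * (2 * (K * (4 * r) ^ α)) + 2 * ((d : ℝ) ^ 2 * Λ) ^ 2
          * (2 * (K * (4 * r) ^ α)) ^ 2 / θ₀ * (L / r ^ 2))
        * ((4 * r) ^ d * (volume (Metric.ball (0 : EuclideanSpace ℝ (Fin d)) 1)).toReal)) := by
  set δ : ℝ := 2 * (K * (4 * r) ^ α) with hδ
  have hδ0 : 0 ≤ δ := by positivity
  set W : ℝ := (4 * r) ^ d * (volume (Metric.ball (0 : EuclideanSpace ℝ (Fin d)) 1)).toReal with hW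
  have hC₁0 : 0 ≤ C₁ := (abs_nonneg _).trans (hC₁ 0)
  set P : Set (EuclideanSpace ℝ (Fin d)) := {y | sineSqDist x y ≤ 2 * (Real.pi ^ 2 * r ^ 2)} with hP
  have hPm : MeasurableSet P :=
    (isClosed_le (contDiff_sineSqDist x).continuous continuous_const).measurableSet
  have hvol : (volume (unitCube d ∩ P)).toReal ≤ W := by
    refine (ENNReal.toReal_mono ?_ (volume_sineSqDist_le x hr.le)).trans_eq ?_
    · exact ENNReal.mul_ne_top ENNReal.ofReal_ne_top measure_ball_lt_top.ne
    · rw [ENNReal.toReal_mul, ENNReal.toReal_ofReal (by positivity)]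
  have hbound : ∀ (f : EuclideanSpace ℝ (Fin d) → ℝ) (b : ℝ), 0 ≤ b → Continuous f →
      (∀ y, f y ≤ b) → (∀ y, y ∉ P → f y = 0) → ∫ y in unitCube d, f y ≤ b * W := by
    intro f b hb hf hfb hf0
    calc ∫ y in unitCube d, f y ≤ ∫ y in unitCube d, P.indicator (fun _ => b) y := by
          refine integral_mono hf.integrableOn_unitCube
            ((integrable_const b).indicator hPm) fun y => ?_
          by_cases hy : y ∈ P
          · rw [Set.indicator_of_mem hy]; exact hfb y
          · rw [Set.indicator_of_notMem hy, hf0 y hy]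
      _ = b * (volume (unitCube d ∩ P)).toReal := by
          rw [integral_indicator_const _ hPm, measureReal_def, Measure.restrict_apply hPm,
            Set.inter_comm, smul_eq_mul, mul_comm]
      _ ≤ b * W := mul_le_mul_of_nonneg_left hvol hb
  have b1 := hbound (fun y => η y ^ 2) 1 zero_le_one (hη.1.continuous.pow 2) h2 fun y hy => by
    simp [(h4 y (not_le.1 hy)).1]
  have b2 := hbound (fun y => ‖gradient η y‖ ^ 2) (L / r ^ 2) (by positivity)
    ((continuous_gradient hη.1).norm.pow 2) h3 fun y hy => by simp [(h4 y (not_le.1 hy)).2]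
  -- On the support of `η`, `u` stays within `K (4 r)^α` of `u x`; `c` is the lower end of this
  -- interval and `δ` its length.
  have hc := h.caccioppoli hθ₀ hC₁ hη (c := u x - K * (4 * r) ^ α) (δ := δ) hδ0 fun y hy => by
    have hyP : y ∈ P := by
      by_contra hn
      exact hy (h4 y (not_le.1 hn)).1
    have := _root_.abs_le.1 (hu.abs_sub_le_of_sineSqDist_le hK hα hr.le hyP)
    constructor <;> linarith [this.1, this.2]
  have hD2 : IntegrableOn (fun x => ‖Du x‖ ^ 2) (unitCube d) :=
    h.sobolev.memLp_grad.integrable_norm_pow (by norm_num)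
  have i1 : IntegrableOn (fun x => η x ^ 2 * ‖Du x‖ ^ 2) (unitCube d) :=
    hD2.bdd_mul (c := 1) (hη.1.continuous.pow 2).aestronglyMeasurable
      (Filter.Eventually.of_forall fun x => by
        rw [Real.norm_eq_abs, abs_of_nonneg (sq_nonneg _)]; exact h2 x)
  have hBm : MeasurableSet (torusBall x r) := by
    have : torusBall x r = ⋃ k : Fin d → ℤ, (fun y => y + WithLp.toLp 2 (fun i => (k i : ℝ))) ⁻¹'
        Metric.ball x r := by
      ext y; simp [torusBall]
    rw [this]
    exact (isOpen_iUnion fun k => Metric.isOpen_ball.preimage (by fun_prop)).measurableSet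
  have hball : ∫ y in unitCube d ∩ torusBall x r, ‖Du y‖ ^ 2
      ≤ ∫ y in unitCube d, η y ^ 2 * ‖Du y‖ ^ 2 := by
    calc ∫ y in unitCube d ∩ torusBall x r, ‖Du y‖ ^ 2
        = ∫ y in unitCube d ∩ torusBall x r, η y ^ 2 * ‖Du y‖ ^ 2 := by
          refine setIntegral_congr_fun ((measurableSet_unitCube d).inter hBm) fun y hy => ?_
          simp only [h1 y hy.2, one_pow, one_mul]
      _ ≤ _ := setIntegral_mono_set i1
          (Filter.Eventually.of_forall fun y => mul_nonneg (sq_nonneg _) (sq_nonneg _))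
          (Filter.Eventually.of_forall Set.inter_subset_left)
  refine hball.trans ?_
  have b3 := mul_le_mul_of_nonneg_left b1 (mul_nonneg hC₁0 hδ0)
  have b4 := mul_le_mul_of_nonneg_left b2
    (show 0 ≤ 2 * ((d : ℝ) ^ 2 * Λ) ^ 2 * δ ^ 2 / θ₀ by positivity)
  rw [div_mul_eq_mul_div, le_div_iff₀ hθ₀]
  linarith

end IsBoundedWeakSolution

/-! ### Uniform constants and the Morrey estimate -/

theorem IsTorusHolder.abs_const {d : ℕ} {K α : ℝ} {u : EuclideanSpace ℝ (Fin d) → ℝ}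
    (hu : IsTorusHolder K α u) : IsTorusHolder |K| α u :=
  ⟨hu.1, fun x y => (hu.2 x y).trans
    (mul_le_mul_of_nonneg_right (le_abs_self K) (Real.rpow_nonneg dist_nonneg α))⟩

theorem IsEllipticMatrix.abs_const {d : ℕ} {θ₀ θ₁ Λ : ℝ}
    {A : EuclideanSpace ℝ (Fin d) → Matrix (Fin d) (Fin d) ℝ} (hA : IsEllipticMatrix θ₀ θ₁ Λ A) :
    IsEllipticMatrix θ₀ θ₁ |Λ| A :=
  { hA with bounded := fun x i j => (hA.bounded x i j).trans (le_abs_self Λ) }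

theorem torusMorreyNorm_two_le {d : ℕ} {lam C : ℝ} (hC : 0 ≤ C)
    {f : EuclideanSpace ℝ (Fin d) → EuclideanSpace ℝ (Fin d)}
    (hf : IntegrableOn (fun x => ‖f x‖ ^ 2) (unitCube d))
    (h : ∀ x r, 0 < r → ∫ y in unitCube d ∩ torusBall x r, ‖f y‖ ^ 2 ≤ C ^ 2 * r ^ lam) :
    torusMorreyNorm 2 lam f ≤ ENNReal.ofReal C := by
  refine iSup_le fun x => iSup_le fun r => iSup_le fun hr => ?_
  have hr' : 0 < r ^ lam := Real.rpow_pos_of_pos hr lam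
  have e1 : ∫⁻ y in unitCube d ∩ torusBall x r, ‖f y‖ₑ ^ (2 : ℝ)
      = ENNReal.ofReal (∫ y in unitCube d ∩ torusBall x r, ‖f y‖ ^ 2) := by
    rw [ofReal_integral_eq_lintegral_ofReal (hf.mono_set Set.inter_subset_left)
      (Filter.Eventually.of_forall fun y => sq_nonneg _)]
    refine lintegral_congr fun y => ?_
    rw [← ofReal_norm, ENNReal.ofReal_rpow_of_nonneg (norm_nonneg _) zero_le_two,
      Real.rpow_two]
  have e2 : (ENNReal.ofReal (r ^ lam))⁻¹
      * ∫⁻ y in unitCube d ∩ torusBall x r, ‖f y‖ₑ ^ (2 : ℝ) ≤ ENNReal.ofReal (C ^ 2) := by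
    rw [e1, ← ENNReal.ofReal_inv_of_pos hr', ← ENNReal.ofReal_mul (inv_pos.2 hr').le]
    refine ENNReal.ofReal_le_ofReal ?_
    rw [inv_mul_le_iff₀ hr', mul_comm]
    exact h x r hr
  refine (ENNReal.rpow_le_rpow e2 (by norm_num)).trans_eq ?_
  rw [ENNReal.ofReal_rpow_of_nonneg (sq_nonneg C) (by norm_num), ← Real.sqrt_eq_rpow,
    Real.sqrt_sq hC]

theorem cutoff_bound_le_mul_rpow {θ₀ C₁ B K L W α r : ℝ} {d : ℕ} (hθ₀ : 0 < θ₀) (hC₁ : 0 ≤ C₁)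
    (hK : 0 ≤ K) (hW : 0 ≤ W) (hα1 : α < 1) (hr : 0 < r) (hr1 : r ≤ 1) :
    2 / θ₀ * ((C₁ * (2 * (K * (4 * r) ^ α)) + 2 * B ^ 2 * (2 * (K * (4 * r) ^ α)) ^ 2 / θ₀
        * (L / r ^ 2)) * ((4 * r) ^ d * W))
      ≤ 2 / θ₀ * ((C₁ * (2 * (K * 4 ^ α)) + 2 * B ^ 2 * (2 * (K * 4 ^ α)) ^ 2 / θ₀ * L)
        * (4 ^ d * W)) * r ^ ((d : ℝ) - 2 + 2 * α) := by
  have e1 : (4 * r) ^ α = 4 ^ α * r ^ α := Real.mul_rpow (by norm_num) hr.le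
  have e2 : r ^ ((d : ℝ) - 2 + 2 * α) = r ^ d * (r ^ α) ^ 2 / r ^ 2 := by
    rw [Real.rpow_add hr, Real.rpow_sub hr, Real.rpow_natCast, Real.rpow_two, mul_comm 2 α,
      Real.rpow_mul hr.le, Real.rpow_two]
    ring
  have hrα : 0 < r ^ α := Real.rpow_pos_of_pos hr α
  -- The coupling contributes only `r^α`; as `r ≤ 1` and `α ≤ 2`, it is dominated by the `r^(2α-2)`
  -- of the cutoff term.
  have e3 : r ^ α ≤ (r ^ α) ^ 2 / r ^ 2 := by
    rw [le_div_iff₀ (by positivity), sq (r ^ α)]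
    refine mul_le_mul_of_nonneg_left ?_ hrα.le
    rw [← Real.rpow_two]
    exact Real.rpow_le_rpow_of_exponent_ge hr hr1 (by linarith)
  have h4 : (0 : ℝ) ≤ 4 ^ α := Real.rpow_nonneg (by norm_num) α
  have e4 : C₁ * (2 * (K * (4 ^ α * r ^ α))) + 2 * B ^ 2 * (2 * (K * (4 ^ α * r ^ α))) ^ 2 / θ₀
        * (L / r ^ 2) ≤ (C₁ * (2 * (K * 4 ^ α)) + 2 * B ^ 2 * (2 * (K * 4 ^ α)) ^ 2 / θ₀ * L)
        * ((r ^ α) ^ 2 / r ^ 2) := by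
    have h5 : C₁ * (2 * (K * 4 ^ α)) * r ^ α ≤ C₁ * (2 * (K * 4 ^ α)) * ((r ^ α) ^ 2 / r ^ 2) :=
      mul_le_mul_of_nonneg_left e3 (by positivity)
    have h6 : 2 * B ^ 2 * (2 * (K * (4 ^ α * r ^ α))) ^ 2 / θ₀ * (L / r ^ 2)
        = 2 * B ^ 2 * (2 * (K * 4 ^ α)) ^ 2 / θ₀ * L * ((r ^ α) ^ 2 / r ^ 2) := by ring
    rw [h6, add_mul]
    linarith
  rw [e1, e2, mul_pow 4 r d]
  calc _ ≤ 2 / θ₀ * ((C₁ * (2 * (K * 4 ^ α)) + 2 * B ^ 2 * (2 * (K * 4 ^ α)) ^ 2 / θ₀ * L)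
        * ((r ^ α) ^ 2 / r ^ 2) * (4 ^ d * r ^ d * W)) :=
        mul_le_mul_of_nonneg_left (mul_le_mul_of_nonneg_right e4 (by positivity)) (by positivity)
    _ = _ := by ring

theorem mainTheorem9 (d : ℕ) (α θ₀ θ₁ Λ Cg CV K : ℝ) (g : ℝ → ℝ)
    (hα0 : 0 < α) (hα1 : α < 1) (hlam : 0 < (d : ℝ) - 2 + 2 * α)
    (hθ₀ : 0 < θ₀) (hθ₁ : 0 < θ₁) (hCg : 0 < Cg) (hg : IsCoupling Cg g) :
    ((d : ℝ) - 2 < (d : ℝ) - 2 + 2 * α ∧ (d : ℝ) - 2 + 2 * α < d) ∧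
    ∃ C : ℝ, 0 < C ∧
      ∀ (A : EuclideanSpace ℝ (Fin d) → Matrix (Fin d) (Fin d) ℝ)
        (V : EuclideanSpace ℝ (Fin d) → ℝ) (H : ℝ)
        (u : EuclideanSpace ℝ (Fin d) → ℝ)
        (Du : EuclideanSpace ℝ (Fin d) → EuclideanSpace ℝ (Fin d)),
        IsEllipticMatrix θ₀ θ₁ Λ A →
        Continuous V → TorusPeriodic V → (∀ x, |V x - H| ≤ CV) →
        IsTorusH1 u Du → IsTorusHolder K α u →
        IsWeakSolution A V H g u Du →
        MemTorusMorrey 2 ((d : ℝ) - 2 + 2 * α) Du ∧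
          torusMorreyNorm 2 ((d : ℝ) - 2 + 2 * α) Du ≤ ENNReal.ofReal C := by
  refine ⟨⟨by linarith, by linarith⟩, ?_⟩
  have hgc : Continuous g := hg.locallyLipschitz.continuous
  -- The constant is fixed before `A`, `V` and `u` are given, and no sign of `CV`, `K` or `Λ` is
  -- assumed; absolute values make every bound nonnegative.
  set M : ℝ := (1 / Cg + |CV|) / Cg + |K| * (2 * √d) ^ α with hM
  have hM0 : 0 ≤ M := by positivity
  obtain ⟨c, hc0, hc⟩ := exists_abs_le_of_continuous hgc M
  obtain ⟨L, hL0, hL⟩ := exists_torus_cutoff d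
  set C₁ : ℝ := c + |CV| with hC₁
  have hC₁0 : 0 ≤ C₁ := by positivity
  set W : ℝ := (volume (Metric.ball (0 : EuclideanSpace ℝ (Fin d)) 1)).toReal with hW
  have hW0 : 0 ≤ W := ENNReal.toReal_nonneg
  -- `D₁` serves radii `r ≥ 1` and `D₂` radii `r ≤ 1`; the `1` added to their sum makes the final
  -- constant positive.
  set D₁ : ℝ := 2 / θ₀ * (C₁ * (2 * M)) with hD₁
  set D₂ : ℝ := 2 / θ₀ * ((C₁ * (2 * (|K| * 4 ^ α))
    + 2 * ((d : ℝ) ^ 2 * |Λ|) ^ 2 * (2 * (|K| * 4 ^ α)) ^ 2 / θ₀ * L) * (4 ^ d * W)) with hD₂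
  have hD₁0 : 0 ≤ D₁ := by positivity
  have hD₂0 : 0 ≤ D₂ := by positivity
  have hC0 : 0 < D₁ + D₂ + 1 := by positivity
  have hsq : √(D₁ + D₂ + 1) ^ 2 = D₁ + D₂ + 1 := Real.sq_sqrt hC0.le
  refine ⟨√(D₁ + D₂ + 1), Real.sqrt_pos.2 hC0, fun A V H u Du hA hV _ hVH hu hHol hw => ?_⟩
  have hHol' := hHol.abs_const
  have hsol : IsBoundedWeakSolution θ₀ θ₁ |Λ| |CV| A V H g u Du :=
    { elliptic := hA.abs_const
      nonneg := abs_nonneg Λ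
      continuous_potential := hV
      potential_le := fun x => (hVH x).trans (le_abs_self CV)
      continuous_coupling := hgc
      sobolev := hu
      continuous := hHol.continuous hα0
      weak := hw }
  have huM : ∀ x, |u x| ≤ M := hsol.abs_le hθ₀ hCg hg hHol' (abs_nonneg K) hα0
  have hF : ∀ x, |g (-u x) - (V x - H)| ≤ C₁ := fun x =>
    (abs_sub _ _).trans (add_le_add (hc _ (by rw [abs_neg]; exact huM x)) (hsol.potential_le x))
  have hD2 : IntegrableOn (fun x => ‖Du x‖ ^ 2) (unitCube d) :=
    hu.memLp_grad.integrable_norm_pow (by norm_num)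
  have hnorm : torusMorreyNorm 2 ((d : ℝ) - 2 + 2 * α) Du ≤ ENNReal.ofReal √(D₁ + D₂ + 1) := by
    refine torusMorreyNorm_two_le (Real.sqrt_nonneg _) hD2 fun x r hr => ?_
    have hrl : 0 < r ^ ((d : ℝ) - 2 + 2 * α) := Real.rpow_pos_of_pos hr _
    rw [hsq]
    rcases le_total r 1 with hr1 | hr1
    · obtain ⟨η, hη, h1, h2, h3, h4⟩ := hL x r hr
      calc _ ≤ D₂ * r ^ ((d : ℝ) - 2 + 2 * α) :=
            (hsol.setIntegral_norm_sq_torusBall_le hθ₀ hF hHol' (abs_nonneg K) hα0 hL0 hr hη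
              h1 h2 h3 h4).trans
              (cutoff_bound_le_mul_rpow hθ₀ hC₁0 (abs_nonneg K) hW0 hα1 hr hr1)
        _ ≤ _ := by gcongr; linarith
    · calc _ ≤ ∫ y in unitCube d, ‖Du y‖ ^ 2 :=
            setIntegral_mono_set hD2 (Filter.Eventually.of_forall fun y => sq_nonneg _)
              (Filter.Eventually.of_forall Set.inter_subset_left)
        _ ≤ D₁ := hsol.setIntegral_norm_sq_le hθ₀ huM hF
        _ ≤ (D₁ + D₂ + 1) * 1 := by linarith
        _ ≤ _ := by
            gcongr
            exact Real.one_le_rpow hr1 hlam.le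
  exact ⟨⟨hu.periodic_grad, hu.memLp_grad.integrable (by norm_num),
    hnorm.trans_lt ENNReal.ofReal_lt_top⟩, hnorm⟩
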